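/- **Setting.** Let $\rho_1,\dots,\rho_N:\mathbb R^n\to\mathbb R$ be convex, with all subgradients of $\rho_i$ bounded in norm by $B_i>0$ and $\rho_i(x)\ge\tau_i\|x\|_2$ for all $x$, where $\tau_i>0$. Let $\gamma_1,\dots,\gamma_N:\mathbb R^n\to\mathbb R$ be convex and differentiable, with $L_{\gamma_i}$-Lipschitz gradients, bounded below by $\underline\gamma_i$, and with $\|\nabla\gamma_i(x)\|_2\le G_i$ for all $x$. Let $A=[A_1,\dots,A_N]$ with $A_i\in\mathbb R^{m\times n}$ be surjective, $b\in\mathbb R^m$, and for $\mathbf x=(x_1,\dots,x_N)\in\mathbb R^{nN}$ put $\bar\rho(\mathbf x)=\sum_i\rho_i(x_i)$, $\bar\gamma(\mathbf x)=\sum_i\gamma_i(x_i)$, $\bar F=\bar\rho+\bar\gamma$, and $\bar F^*=\min\{\bar F(\mathbf x):A\mathbf x=b\}$. Write $\sigma_{\max}(A)$ for the largest singular value of $A$ and $\sigma_{\min}(A_i)$ for the smallest of the $\min(m,n)$ singular values of $A_i$ (similarly $\sigma_{\min}(A)$). Assume $\sigma_{\min}(A_i)>0$ for all $i$ and put $\Theta=\sigma_{\max}(A)/\min_i\sigma_{\min}(A_i)$.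 **DFAL.** Given $c\in(0,1)$, $\mathbf x^{(0)}$ and $\lambda^{(1)},\alpha^{(1)},\xi^{(1)}>0$ with $\xi^{(1)}/\lambda^{(1)}<\min_i\tau_i$, put $\theta^{(1)}=0$, and for $k\ge1$ let $$f^{(k)}(\mathbf x)=\lambda^{(k)}\bar\gamma(\mathbf x)+\tfrac12\|A\mathbf x-b-\lambda^{(k)}\theta^{(k)}\|_2^2,\qquad P^{(k)}=\lambda^{(k)}\bar\rho+f^{(k)}.$$ Call $\mathbf x$ *acceptable* at step $k$ if (a) $P^{(k)}(\mathbf x)-\min P^{(k)}\le\alpha^{(k)}$, or (b) there are $g_i\in\lambda^{(k)}\partial\rho_i(x_i)+\nabla_{x_i}f^{(k)}(\mathbf x)$ with $\max_i\|g_i\|_2\le\xi^{(k)}/\sqrt N$. Run MS-APG on $P^{(k)}$ from $\mathbf y^{(0)}=\bar{\mathbf y}^{(1)}=\mathbf x^{(k-1)}$, $t^{(1)}=1$: for $\ell\ge1$, $$y_i^{(\ell)}=\mathbf{prox}_{\lambda^{(k)}\rho_i/L_i^{(k)}}\bigl(\bar y_i^{(\ell)}-\nabla_{y_i}f^{(k)}(\bar{\mathbf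 y}^{(\ell)})/L_i^{(k)}\bigr),\quad t^{(\ell+1)}=\tfrac12\Bigl(1+\sqrt{1+4(t^{(\ell)})^2}\Bigr),\quad \bar{\mathbf y}^{(\ell+1)}=\mathbf y^{(\ell)}+\tfrac{t^{(\ell)}-1}{t^{(\ell+1)}}(\mathbf y^{(\ell)}-\mathbf y^{(\ell-1)}),$$ where $L_i^{(k)}=\lambda^{(k)}L_{\gamma_i}+\sigma_{\max}^2(A)$ and $\mathbf{prox}_h(x)=\arg\min_y\{h(y)+\frac12\|y-x\|_2^2\}$. Let $N^{(k)}$ be the least $\ell\ge1$ such that $\mathbf y^{(\ell)}$ is acceptable, and set $\mathbf x^{(k)}=\mathbf y^{(N^{(k)})}$, $\theta^{(k+1)}=\theta^{(k)}-(A\mathbf x^{(k)}-b)/\lambda^{(k)}$, $\lambda^{(k+1)}=c\lambda^{(k)}$, $\alpha^{(k+1)}=c^2\alpha^{(k)}$, $\xi^{(k+1)}=c^2\xi^{(k)}$. For $\epsilon>0$ let $N^o(\epsilon)$ (resp. $N^f(\epsilon)$) be the least $K\ge1$ such that for all $k\ge K$ the iterate $\mathbf x^{(k)}$ is $\epsilon$-optimal,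 $|\bar F(\mathbf x^{(k)})-\bar F^*|\le\epsilon$ (resp. $\epsilon$-feasible, $\|A\mathbf x^{(k)}-b\|_2\le\epsilon$). **Theorem.** Let $s>0$ and $\kappa,D\in\mathbb R$. There is a constant $C>0$, depending only on $N$, $c$, $\lambda^{(1)},\alpha^{(1)},\xi^{(1)}$, the constants $\tau_i,B_i,G_i,L_{\gamma_i}$, and $s,\kappa,D$, such that whenever $\sigma_{\max}(A)\ge s$, $\bar F^*-\sum_i\underline\gamma_i\le D$, $\|\mathbf x^{(0)}\|_2\le D$, and, only in the case $m>n$, $\min_i\sigma_{\min}(A_i)\le\kappa\,\sigma_{\min}(A)$, all $N^{(k)}$ are finite, and for every $0<\epsilon\le1$ the numbers $N^o(\epsilon)$, $N^f(\epsilon)$ are finite with $$\sum_{k=1}^{N^o(\epsilon)}N^{(k)}\le C\,\Theta^2\sigma_{\max}(A)\,\epsilon^{-1},\qquad \sum_{k=1}^{N^f(\epsilon)}N^{(k)}\le C\,\Theta\,\sigma_{\max}(A)\,\epsilon^{-1}.$$ -/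

import Mathlib

open scoped InnerProductSpace

noncomputable section

namespace DFAL

/-- `ℝⁿ` with its Euclidean norm. -/
abbrev Vec (n : ℕ) : Type := EuclideanSpace ℝ (Fin n)

/-- `ℝ^{nN}`, as `N` blocks `x i ∈ ℝⁿ`, with the Euclidean norm of the concatenated vector. -/
abbrev BlockVec (N n : ℕ) : Type := PiLp 2 (fun _ : Fin N => Vec n)

/-! ### Singular values -/

section SingularValues

variable {E F : Type*} [NormedAddCommGroup E] [InnerProductSpace ℝ E] [FiniteDimensional ℝ E]
  [NormedAddCommGroup F] [InnerProductSpace ℝ F] [FiniteDimensional ℝ F]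

/-- The largest singular value. -/
def sigmaMax (T : E →ₗ[ℝ] F) : ℝ := T.singularValues 0

/-- The smallest of the `min (dim E) (dim F)` singular values `σ₁ ≥ σ₂ ≥ …` of `T : E → F`
(Mathlib numbers them from `0`). -/
def sigmaMin (T : E →ₗ[ℝ] F) : ℝ :=
  T.singularValues (min (Module.finrank ℝ E) (Module.finrank ℝ F) - 1)

end SingularValues

/-! ### The function classes -/

/-- `q` is a subgradient of `h` at `x`. -/
def IsSubgradient {n : ℕ} (h : Vec n → ℝ) (x q : Vec n) : Prop :=
  ∀ z, h x + ⟪q, z - x⟫_ℝ ≤ h z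

/-- `g` is convex, has an `L`-Lipschitz gradient, and is bounded below by `low`. -/
structure IsSmoothTerm {n : ℕ} (g : Vec n → ℝ) (L low : ℝ) : Prop where
  convex : ConvexOn ℝ Set.univ g
  differentiable : Differentiable ℝ g
  lipschitz : ∀ x y, ‖gradient g x - gradient g y‖ ≤ L * ‖x - y‖
  lower : ∀ x, low ≤ g x

/-- `h` is convex, all its subgradients have norm at most `B`, and `τ ‖x‖ ≤ h x` with `τ > 0`. -/
structure IsRegularizer {n : ℕ} (h : Vec n → ℝ) (B τ : ℝ) : Prop where
  convex : ConvexOn ℝ Set.univ h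
  bound_pos : 0 < B
  subgradient_le : ∀ x q, IsSubgradient h x q → ‖q‖ ≤ B
  tau_pos : 0 < τ
  coercive : ∀ x, τ * ‖x‖ ≤ h x

/-! ### The problem `min ∑ ρᵢ(xᵢ) + γᵢ(xᵢ)` subject to `∑ Aᵢ xᵢ = b` -/

/-- The data of the problem; `A i` is the `m × n` block `Aᵢ` of `A = [A₁, …, A_N]`. -/
structure Problem (N n m : ℕ) where
  rho : Fin N → Vec n → ℝ
  gamma : Fin N → Vec n → ℝ
  A : Fin N → (Vec n →ₗ[ℝ] Vec m)
  b : Vec m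

namespace Problem

variable {N n m : ℕ} (P : Problem N n m)

/-- The full map `A x = ∑ Aᵢ xᵢ`. -/
def fullA : BlockVec N n →ₗ[ℝ] Vec m :=
  ∑ i, (P.A i).comp (PiLp.proj 2 (fun _ : Fin N => Vec n) i : BlockVec N n →L[ℝ] Vec n).toLinearMap

def rhoBar (x : BlockVec N n) : ℝ := ∑ i, P.rho i (x i)

def gammaBar (x : BlockVec N n) : ℝ := ∑ i, P.gamma i (x i)

/-- The objective. -/
def F (x : BlockVec N n) : ℝ := P.rhoBar x + P.gammaBar x

/-- The optimal value. -/
def optVal : ℝ := sInf (P.F '' {x | P.fullA x = P.b})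

/-- `min_i σ_min(Aᵢ)`. -/
def minSigma : ℝ := ⨅ i, sigmaMin (P.A i)

/-- `Θ = σ_max(A) / min_i σ_min(Aᵢ)`. -/
def Theta : ℝ := sigmaMax P.fullA / P.minSigma

/-- `f(x) = λ γ̄(x) + ½ ‖A x - b - λ θ‖²`. -/
def smoothPart (lam : ℝ) (θ : Vec m) (x : BlockVec N n) : ℝ :=
  lam * P.gammaBar x + 1 / 2 * ‖P.fullA x - P.b - lam • θ‖ ^ 2

/-- The objective `λ ρ̄(x) + f(x)` of the subproblem. -/
def subObj (lam : ℝ) (θ : Vec m) (x : BlockVec N n) : ℝ :=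
  lam * P.rhoBar x + P.smoothPart lam θ x

/-- The inexactness condition for the subproblem: either
(a) `x` is `α`-optimal, or
(b) there are partial subgradients `gᵢ = λ qᵢ + ∇_{xᵢ} f(x)`, `qᵢ ∈ ∂ρᵢ(xᵢ)`, all of norm at most
`ξ / √N`. -/
def Accept (lam α ξ : ℝ) (θ : Vec m) (x : BlockVec N n) : Prop :=
  (∀ z, P.subObj lam θ x - P.subObj lam θ z ≤ α) ∨
  ∃ q : Fin N → Vec n, ∀ i, IsSubgradient (P.rho i) (x i) (q i) ∧
    ‖lam • q i + gradient (P.smoothPart lam θ) x i‖ ≤ ξ / Real.sqrt N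

end Problem

/-! ### The inner solver MS-APG -/

/-- `prox_h(x) = argmin_y h(y) + ½ ‖y - x‖²`. -/
def prox {n : ℕ} (h : Vec n → ℝ) (x : Vec n) : Vec n :=
  Classical.epsilon fun p => ∀ y, h p + 1 / 2 * ‖p - x‖ ^ 2 ≤ h y + 1 / 2 * ‖y - x‖ ^ 2

/-- After `ℓ` iterations: `y = y^(ℓ)`, `ybar = ȳ^(ℓ+1)`, `t = t^(ℓ+1)`. -/
structure APGState (N n : ℕ) where
  y : BlockVec N n
  ybar : BlockVec N n
  t : ℝ

/-- One MS-APG iteration for `∑ hᵢ(yᵢ) + f(y)` with step lengths `1 / Lᵢ`. -/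
def apgStep {N n : ℕ} (h : Fin N → Vec n → ℝ) (f : BlockVec N n → ℝ) (L : Fin N → ℝ)
    (s : APGState N n) : APGState N n :=
  let y' : BlockVec N n := WithLp.toLp 2 fun i =>
    prox (fun z => h i z / L i) (s.ybar i - (1 / L i) • gradient f s.ybar i)
  let t' : ℝ := (1 + Real.sqrt (1 + 4 * s.t ^ 2)) / 2
  { y := y'
    ybar := y' + ((s.t - 1) / t') • (y' - s.y)
    t := t' }

/-- The state after `ℓ` MS-APG iterations started at `y0`. -/
def apg {N n : ℕ} (h : Fin N → Vec n → ℝ) (f : BlockVec N n → ℝ) (L : Fin N → ℝ)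
    (y0 : BlockVec N n) : ℕ → APGState N n
  | 0 => { y := y0, ybar := y0, t := 1 }
  | ℓ + 1 => apgStep h f L (apg h f L y0 ℓ)

/-! ### The outer algorithm DFAL -/

/-- The state after `k` DFAL iterations:
`x = x^(k)`, `θ = θ^(k+1)`, `lam = λ^(k+1)`, `α = α^(k+1)`, `ξ = ξ^(k+1)`. -/
structure State (N n m : ℕ) where
  x : BlockVec N n
  θ : Vec m
  lam : ℝ
  α : ℝ
  ξ : ℝ

namespace Problem

variable {N n m : ℕ} (P : Problem N n m)

/-- The `ℓ`-th MS-APG iterate in the DFAL iteration that starts from the state `s`; the step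
lengths are `1 / Lᵢ` with `Lᵢ = λ L_{γᵢ} + σ_max(A)²`. -/
def innerIterate (Lγ : Fin N → ℝ) (s : State N n m) (ℓ : ℕ) : BlockVec N n :=
  (apg (fun i z => s.lam * P.rho i z) (P.smoothPart s.lam s.θ)
    (fun i => s.lam * Lγ i + sigmaMax P.fullA ^ 2) s.x ℓ).y

/-- The numbers `ℓ ≥ 1` of MS-APG iterations after which the inexactness condition holds. -/
def acceptedCounts (Lγ : Fin N → ℝ) (s : State N n m) : Set ℕ :=
  {ℓ | 1 ≤ ℓ ∧ P.Accept s.lam s.α s.ξ s.θ (P.innerIterate Lγ s ℓ)}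

/-- The number of MS-APG iterations made in the DFAL iteration that starts from `s`. -/
def innerCount (Lγ : Fin N → ℝ) (s : State N n m) : ℕ := sInf (P.acceptedCounts Lγ s)

/-- One DFAL iteration. -/
def dfalStep (Lγ : Fin N → ℝ) (c : ℝ) (s : State N n m) : State N n m :=
  let x' := P.innerIterate Lγ s (P.innerCount Lγ s)
  { x := x'
    θ := s.θ - (1 / s.lam) • (P.fullA x' - P.b)
    lam := c * s.lam
    α := c ^ 2 * s.α
    ξ := c ^ 2 * s.ξ }

/-- The state after `k` DFAL iterations, from `x^(0) = x0`, `θ^(1) = 0`, `λ^(1) = lam1`,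
`α^(1) = α1`, `ξ^(1) = ξ1`. -/
def dfal (Lγ : Fin N → ℝ) (c lam1 α1 ξ1 : ℝ) (x0 : BlockVec N n) : ℕ → State N n m
  | 0 => { x := x0, θ := 0, lam := lam1, α := α1, ξ := ξ1 }
  | k + 1 => P.dfalStep Lγ c (dfal Lγ c lam1 α1 ξ1 x0 k)

/-- Total number of MS-APG iterations made in the DFAL iterations `1, …, K`. -/
def totalInner (Lγ : Fin N → ℝ) (c lam1 α1 ξ1 : ℝ) (x0 : BlockVec N n) (K : ℕ) : ℕ :=
  ∑ k ∈ Finset.range K, P.innerCount Lγ (P.dfal Lγ c lam1 α1 ξ1 x0 k)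

def EpsOptimal (ε : ℝ) (x : BlockVec N n) : Prop := |P.F x - P.optVal| ≤ ε

def EpsFeasible (ε : ℝ) (x : BlockVec N n) : Prop := ‖P.fullA x - P.b‖ ≤ ε

end Problem

end DFAL

end

/-!
Write `θ⁺ = θ - (A x - b) / λ` for the multiplier computed from an iterate `x` accepted with
multiplier `θ` and parameter `λ`. Completing the square, the subproblem is to minimize
`λ F(x) + λ² ‖θ⁺‖² / 2`, and both alternatives of the inexactness condition make `x` a minimizer up
to `α + ξ ‖x - z‖` against every competitor `z`. The estimates come from three competitors.

* An optimal `x*` gives `F(x) - F* + λ/2 ‖θ⁺‖² ≤ λ/2 ‖θ‖² + α/λ + ξ/λ ‖x - x*‖`. As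
  `ξ⁽¹⁾/λ⁽¹⁾ < min τᵢ`, the coercivity of `F` absorbs the last term, so `λ ‖θ⁺‖²` exceeds
  `λ ‖θ‖²` by at most a constant. The factor `c < 1` between consecutive `λ` keeps the energy
  `λ ‖θ‖²` bounded, and with it the iterates and the minimizers of the subproblems.
* `x + λ d` with `A d = θ⁺` cancels the penalty. Such a `d` exists with `‖d‖ = O(Θ ‖θ⁺‖)`, and
  `F` is Lipschitz, whence `‖θ⁺‖ = O(Θ)` and `‖A x - b‖ = λ ‖θ - θ⁺‖ = O(Θ λ)`. Inserted in the
  first estimate, this bounds `F(x) - F*` by `O(Θ² λ)`.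
* `x + d` with `A d = b - A x` is feasible, whence `F* - F(x) = O(Θ ‖A x - b‖) = O(Θ² λ)`.

MS-APG reaches accuracy `O(σ_max(A)² / ℓ²)` after `ℓ` steps, while accuracy `α`, proportional to
`λ²`, is enough: step `k` takes `O(σ_max(A) / λ⁽ᵏ⁾)` inner iterations. As `λ⁽ᵏ⁾` is geometric,
their sum up to the first `k` with `Q λ⁽ᵏ⁾ ≤ ε` is `O(Q σ_max(A) / ε)`.
-/

noncomputable section

namespace DFAL

/-! ### Convex functions -/

section AffineMinorant

variable {E : Type*} [AddCommGroup E] [Module ℝ E] [TopologicalSpace E] [IsTopologicalAddGroup E]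
  [ContinuousSMul ℝ E]

theorem exists_affine_minorant {h : E → ℝ} (hh : ConvexOn ℝ Set.univ h) (hcont : Continuous h)
    (x : E) : ∃ u : E →L[ℝ] ℝ, ∀ z, h x + u (z - x) ≤ h z := by
  have hopen : IsOpen {p : E × ℝ | p.1 ∈ Set.univ ∧ h p.1 < p.2} := by
    simp only [Set.mem_univ, true_and]
    exact isOpen_lt (hcont.comp continuous_fst) continuous_snd
  obtain ⟨l, hl⟩ := geometric_hahn_banach_open_point hh.convex_strict_epigraph hopen
    (x := (x, h x)) (by simp)
  set a : ℝ := l (0, 1)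
  have l_apply (z : E) (r : ℝ) : l (z, r) = l (z, 0) + r * a := by
    have split : ((z, r) : E × ℝ) = (z, 0) + r • (0, 1) := by simp
    rw [split, map_add, map_smul, smul_eq_mul]
  have separation {z : E} {r : ℝ} (hr : h z < r) : l (z, 0) + r * a < l (x, 0) + h x * a := by
    rw [← l_apply z r, ← l_apply x (h x)]
    exact hl (z, r) ⟨Set.mem_univ z, hr⟩
  have a_neg : a < 0 := by linarith [separation (lt_add_one (h x))]
  refine ⟨(-a)⁻¹ • l.comp (ContinuousLinearMap.inl ℝ E ℝ), fun z =>
    le_of_forall_gt_imp_ge_of_dense fun r hr => ?_⟩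
  have hu : l (z - x, 0) = l (z, 0) - l (x, 0) := by rw [← map_sub]; simp
  simp only [smul_apply, ContinuousLinearMap.comp_apply, ContinuousLinearMap.inl_apply, hu,
    smul_eq_mul]
  rw [← le_sub_iff_add_le', inv_mul_le_iff₀ (neg_pos.2 a_neg)]
  linarith [separation hr]

end AffineMinorant

section Subgradient

variable {n : ℕ} {h : Vec n → ℝ}

theorem exists_isSubgradient (hh : ConvexOn ℝ Set.univ h) (x : Vec n) :
    ∃ q, IsSubgradient h x q := by
  obtain ⟨u, hu⟩ := exists_affine_minorant hh hh.locallyLipschitz.continuous x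
  exact ⟨(InnerProductSpace.toDual ℝ (Vec n)).symm u, fun z => by
    simpa only [InnerProductSpace.toDual_symm_apply] using hu z⟩

theorem IsSubgradient.sub_le {x q : Vec n} {B : ℝ} (hq : IsSubgradient h x q) (hB : ‖q‖ ≤ B)
    (z : Vec n) : h x - h z ≤ B * ‖x - z‖ :=
  calc h x - h z ≤ -⟪q, z - x⟫_ℝ := by linarith [hq z]
    _ = ⟪q, x - z⟫_ℝ := by rw [← inner_neg_right, neg_sub]
    _ ≤ ‖q‖ * ‖x - z‖ := real_inner_le_norm _ _
    _ ≤ B * ‖x - z‖ := by gcongr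

theorem IsRegularizer.sub_le {B τ : ℝ} (hh : IsRegularizer h B τ) (x z : Vec n) :
    h x - h z ≤ B * ‖x - z‖ := by
  obtain ⟨q, hq⟩ := exists_isSubgradient hh.convex x
  exact hq.sub_le (hh.subgradient_le x q hq) z

end Subgradient

section Gradient

variable {E : Type*} [NormedAddCommGroup E] [InnerProductSpace ℝ E] [CompleteSpace E] {f : E → ℝ}

theorem hasDerivAt_comp_add_smul (hf : Differentiable ℝ f) (x d : E) (t : ℝ) :
    HasDerivAt (fun t : ℝ => f (x + t • d)) ⟪gradient f (x + t • d), d⟫_ℝ t := by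
  have line : HasDerivAt (fun t : ℝ => x + t • d) d t := by
    simpa using ((hasDerivAt_id t).smul_const d).const_add x
  rw [inner_gradient_left]
  exact (hf (x + t • d)).hasFDerivAt.comp_hasDerivAt t line

theorem add_inner_gradient_le_of_convexOn (hc : ConvexOn ℝ Set.univ f) (hf : Differentiable ℝ f)
    (x z : E) : f x + ⟪gradient f x, z - x⟫_ℝ ≤ f z := by
  have convex_line : ConvexOn ℝ Set.univ (fun t : ℝ => f (x + t • (z - x))) :=
    (hc.comp_affineMap (AffineMap.lineMap x z : ℝ →ᵃ[ℝ] E)).congr fun t _ => by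
      simp [AffineMap.lineMap_apply, add_comm]
  have slope_le := convex_line.le_slope_of_hasDerivAt (Set.mem_univ 0) (Set.mem_univ 1) one_pos
    (hasDerivAt_comp_add_smul hf x (z - x) 0)
  simp only [slope, sub_zero, inv_one, zero_smul, add_zero, one_smul, vsub_eq_sub,
    add_sub_cancel] at slope_le
  linarith

theorem le_add_inner_gradient_add_sq_norm (hf : Differentiable ℝ f) {L : ℝ}
    (hL : ∀ x y, ‖gradient f x - gradient f y‖ ≤ L * ‖x - y‖) (x z : E) :
    f z ≤ f x + ⟪gradient f x, z - x⟫_ℝ + L / 2 * ‖z - x‖ ^ 2 := by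
  obtain ⟨d, rfl⟩ : ∃ d, z = x + d := ⟨z - x, (add_sub_cancel x z).symm⟩
  rw [add_sub_cancel_left]
  let ψ : ℝ → ℝ := fun t => f (x + t • d) - t * ⟪gradient f x, d⟫_ℝ - t ^ 2 * (L / 2 * ‖d‖ ^ 2)
  have hψ (t : ℝ) : HasDerivAt ψ (⟪gradient f (x + t • d), d⟫_ℝ - 1 * ⟪gradient f x, d⟫_ℝ
      - (2 * t) * (L / 2 * ‖d‖ ^ 2)) t := by
    refine ((hasDerivAt_comp_add_smul hf x d t).sub ((hasDerivAt_id t).mul_const _)).sub ?_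
    simpa using (hasDerivAt_pow 2 t).mul_const (L / 2 * ‖d‖ ^ 2)
  have slope_growth {t : ℝ} (ht : 0 ≤ t) :
      ⟪gradient f (x + t • d) - gradient f x, d⟫_ℝ ≤ t * (L * ‖d‖ ^ 2) :=
    calc ⟪gradient f (x + t • d) - gradient f x, d⟫_ℝ
        ≤ ‖gradient f (x + t • d) - gradient f x‖ * ‖d‖ := real_inner_le_norm _ _
      _ ≤ L * ‖x + t • d - x‖ * ‖d‖ := by gcongr; exact hL _ _
      _ = t * (L * ‖d‖ ^ 2) := by
        rw [add_sub_cancel_left, norm_smul, Real.norm_of_nonneg ht]; ring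
  have ψ_antitone : AntitoneOn ψ (Set.Icc 0 1) := by
    refine antitoneOn_of_deriv_nonpos (convex_Icc 0 1)
      (fun t _ => (hψ t).continuousAt.continuousWithinAt)
      (fun t _ => (hψ t).differentiableAt.differentiableWithinAt) fun t ht => ?_
    rw [interior_Icc] at ht
    have := slope_growth ht.1.le
    rw [inner_sub_left] at this
    rw [(hψ t).deriv]
    linarith
  have ψ_one_le := ψ_antitone (by simp) (by simp) (zero_le_one : (0 : ℝ) ≤ 1)
  simp only [ψ, one_smul, zero_smul, add_zero] at ψ_one_le
  linarith

theorem IsSmoothTerm.sub_le {n : ℕ} {g : Vec n → ℝ} {L low G : ℝ} (hg : IsSmoothTerm g L low)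
    (hG : ∀ x, ‖gradient g x‖ ≤ G) (x z : Vec n) : g x - g z ≤ G * ‖x - z‖ :=
  IsSubgradient.sub_le (add_inner_gradient_le_of_convexOn hg.convex hg.differentiable x) (hG x) z

end Gradient

section StrongConvexity

variable {E : Type*} [NormedAddCommGroup E]

theorem add_sq_norm_sub_le_of_isMinOn [NormedSpace ℝ E] {f : E → ℝ} {s : Set E} {μ : ℝ}
    (hf : StrongConvexOn s μ f) {p y : E} (hp : p ∈ s) (hmin : IsMinOn f s p) (hy : y ∈ s) :
    f p + μ / 2 * ‖p - y‖ ^ 2 ≤ f y := by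
  have on_segment (t : ℝ) (ht : t ∈ Set.Ioo (0 : ℝ) 1) :
      f p + (1 - t) * (μ / 2 * ‖p - y‖ ^ 2) ≤ f y := by
    have ht' : 0 ≤ 1 - t := by linarith [ht.2]
    have min_le := hmin (hf.1 hp hy ht' ht.1.le (by ring))
    have le_chord := hf.2 hp hy ht' ht.1.le (by ring)
    simp only [smul_eq_mul, Set.mem_ofPred_eq] at min_le le_chord
    refine le_of_mul_le_mul_left ?_ ht.1
    linarith
  have limit : Filter.Tendsto (fun t : ℝ => f p + (1 - t) * (μ / 2 * ‖p - y‖ ^ 2))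
      (nhdsWithin 0 (Set.Ioi 0)) (nhds (f p + (1 - 0) * (μ / 2 * ‖p - y‖ ^ 2))) :=
    ((by fun_prop : Continuous fun t : ℝ => f p + (1 - t) * (μ / 2 * ‖p - y‖ ^ 2)).tendsto
      0).mono_left nhdsWithin_le_nhds
  rw [sub_zero, one_mul] at limit
  exact le_of_tendsto limit
    (Filter.mem_of_superset (Ioo_mem_nhdsGT (zero_lt_one' ℝ)) on_segment)

theorem strongConvexOn_add_sq_norm_sub [InnerProductSpace ℝ E] {h : E → ℝ} {s : Set E}
    (hh : ConvexOn ℝ s h) (x : E) : StrongConvexOn s 1 fun y => h y + 1 / 2 * ‖y - x‖ ^ 2 := by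
  rw [strongConvexOn_iff_convex]
  have affine : ConvexOn ℝ s fun y => (-innerSL ℝ x : E →L[ℝ] ℝ) y + 1 / 2 * ‖x‖ ^ 2 :=
    ((-innerSL ℝ x : E →L[ℝ] ℝ).toLinearMap.convexOn hh.1).add_const _
  refine (hh.add affine).congr fun y _ => ?_
  simp only [Pi.add_apply, neg_apply, innerSL_apply_apply, norm_sub_sq_real]
  rw [real_inner_comm]
  ring

end StrongConvexity

/-! ### The proximal map -/

section Prox

variable {n : ℕ} {h : Vec n → ℝ}

theorem exists_forall_prox_objective_le (hc : ConvexOn ℝ Set.univ h) (x : Vec n) :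
    ∃ p, ∀ y, h p + 1 / 2 * ‖p - x‖ ^ 2 ≤ h y + 1 / 2 * ‖y - x‖ ^ 2 := by
  have hcont : Continuous h := hc.locallyLipschitz.continuous
  obtain ⟨q, hq⟩ := exists_isSubgradient hc x
  refine (by fun_prop : Continuous fun y : Vec n =>
    h y + 1 / 2 * ‖y - x‖ ^ 2).exists_forall_le_of_isBounded x
      ((Metric.isBounded_closedBall (x := x) (r := 2 * ‖q‖)).subset fun y hy => ?_)
  simp only [sub_self, norm_zero, Set.mem_ofPred_eq] at hy
  rw [Metric.mem_closedBall, dist_eq_norm]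
  have minorant := hq.sub_le le_rfl y
  rw [norm_sub_rev] at minorant
  nlinarith [norm_nonneg (y - x), norm_nonneg q]

theorem prox_isMinOn (hc : ConvexOn ℝ Set.univ h) (x : Vec n) :
    IsMinOn (fun y => h y + 1 / 2 * ‖y - x‖ ^ 2) Set.univ (prox h x) := fun y _ =>
  Classical.epsilon_spec (exists_forall_prox_objective_le hc x) y

theorem prox_three_point (hc : ConvexOn ℝ Set.univ h) (x y : Vec n) :
    h (prox h x) + 1 / 2 * ‖prox h x - x‖ ^ 2 + 1 / 2 * ‖prox h x - y‖ ^ 2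
      ≤ h y + 1 / 2 * ‖y - x‖ ^ 2 :=
  add_sq_norm_sub_le_of_isMinOn (strongConvexOn_add_sq_norm_sub hc x) (Set.mem_univ _)
    (prox_isMinOn hc x) (Set.mem_univ y)

theorem prox_gradient_three_point (hc : ConvexOn ℝ Set.univ h) {L : ℝ} (hL : 0 < L)
    {x g p : Vec n} (hp : prox (fun y => h y / L) (x - (1 / L) • g) = p) (z : Vec n) :
    h p + ⟪g, p - x⟫_ℝ + 1 / 2 * (L * ‖p - x‖ ^ 2) + 1 / 2 * (L * ‖p - z‖ ^ 2)
      ≤ h z + ⟪g, z - x⟫_ℝ + 1 / 2 * (L * ‖z - x‖ ^ 2) := by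
  have complete_square (w : Vec n) : L * ‖w - (x - (1 / L) • g)‖ ^ 2
      = L * ‖w - x‖ ^ 2 + 2 * ⟪g, w - x⟫_ℝ + ‖g‖ ^ 2 / L := by
    rw [sub_sub_eq_add_sub, add_sub_right_comm, norm_add_sq_real, inner_smul_right, norm_smul,
      real_inner_comm, Real.norm_of_nonneg (by positivity)]
    field_simp
  have hc' : ConvexOn ℝ Set.univ fun y => h y / L := by
    simpa only [div_eq_inv_mul, smul_eq_mul] using hc.smul (inv_nonneg.2 hL.le)
  have scaled := mul_le_mul_of_nonneg_left (prox_three_point hc' (x - (1 / L) • g) z) hL.le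
  rw [hp, mul_add, mul_add, mul_add, mul_div_cancel₀ _ hL.ne', mul_div_cancel₀ _ hL.ne'] at scaled
  linarith [complete_square p, complete_square z]

end Prox

/-! ### The accelerated proximal gradient method -/

section APG

variable {N n : ℕ}

/-- The squared norm `∑ Lᵢ ‖dᵢ‖²` in which MS-APG measures distances. -/
def weightedSq (L : Fin N → ℝ) (d : BlockVec N n) : ℝ := ∑ i, L i * ‖d i‖ ^ 2

theorem weightedSq_smul (L : Fin N → ℝ) (r : ℝ) (d : BlockVec N n) :
    weightedSq L (r • d) = r ^ 2 * weightedSq L d := by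
  simp only [weightedSq, Finset.mul_sum, PiLp.smul_apply, norm_smul, mul_pow, Real.norm_eq_abs,
    sq_abs]
  exact Finset.sum_congr rfl fun i _ => by ring

theorem weightedSq_nonneg {L : Fin N → ℝ} (hL : ∀ i, 0 ≤ L i) (d : BlockVec N n) :
    0 ≤ weightedSq L d :=
  Finset.sum_nonneg fun i _ => mul_nonneg (hL i) (sq_nonneg _)

theorem weightedSq_le {L : Fin N → ℝ} {M : ℝ} (hL : ∀ i, L i ≤ M) (d : BlockVec N n) :
    weightedSq L d ≤ M * ‖d‖ ^ 2 := by
  rw [PiLp.norm_sq_eq_of_L2, Finset.mul_sum]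
  exact Finset.sum_le_sum fun i _ => mul_le_mul_of_nonneg_right (hL i) (sq_nonneg _)

/-- The objective `∑ hᵢ(xᵢ) + f(x)` that MS-APG minimizes. -/
def compositeObj (h : Fin N → Vec n → ℝ) (f : BlockVec N n → ℝ) (x : BlockVec N n) : ℝ :=
  ∑ i, h i (x i) + f x

/-- The standing assumptions of MS-APG; instead of asking for a Lipschitz gradient, the step
lengths `1 / Lᵢ` are tied to `f` through the quadratic upper bound that a Lipschitz gradient
provides. -/
structure IsCompositeProblem (h : Fin N → Vec n → ℝ) (f : BlockVec N n → ℝ) (L : Fin N → ℝ) :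
    Prop where
  weight_pos : ∀ i, 0 < L i
  convex_block : ∀ i, ConvexOn ℝ Set.univ (h i)
  convex_smooth : ConvexOn ℝ Set.univ f
  differentiable : Differentiable ℝ f
  le_quadratic : ∀ x z, f z ≤ f x + ⟪gradient f x, z - x⟫_ℝ + 1 / 2 * weightedSq L (z - x)

-- A shortcut: the search through the nested `PiLp` is too slow where a derivative needs it.
instance instContinuousSMulBlockVec (N n : ℕ) : ContinuousSMul ℝ (BlockVec N n) :=
  IsBoundedSMul.continuousSMul

theorem convexOn_sum_block {h : Fin N → Vec n → ℝ} (hc : ∀ i, ConvexOn ℝ Set.univ (h i)) :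
    ConvexOn ℝ Set.univ fun x : BlockVec N n => ∑ i, h i (x i) := by
  have := Finset.univ.sum_induction (fun i => fun x : BlockVec N n => h i (x i))
    (ConvexOn ℝ Set.univ) (fun _ _ => ConvexOn.add) (convexOn_const 0 convex_univ)
    fun i _ => (hc i).comp_linearMap (PiLp.proj 2 (fun _ : Fin N => Vec n) i :
      BlockVec N n →L[ℝ] Vec n).toLinearMap
  simpa only [Finset.sum_fn] using this

variable {h : Fin N → Vec n → ℝ} {f : BlockVec N n → ℝ} {L : Fin N → ℝ}

namespace IsCompositeProblem

theorem convexOn_compositeObj (H : IsCompositeProblem h f L) :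
    ConvexOn ℝ Set.univ (compositeObj h f) :=
  (convexOn_sum_block H.convex_block).add H.convex_smooth

theorem compositeObj_apgStep_le (H : IsCompositeProblem h f L) (s : APGState N n)
    (z : BlockVec N n) :
    compositeObj h f (apgStep h f L s).y + 1 / 2 * weightedSq L ((apgStep h f L s).y - z)
      ≤ compositeObj h f z + 1 / 2 * weightedSq L (z - s.ybar) := by
  set p := (apgStep h f L s).y
  set g := gradient f s.ybar with hg
  have block_le := Finset.sum_le_sum fun i (_ : i ∈ Finset.univ) =>
    prox_gradient_three_point (H.convex_block i) (H.weight_pos i) (x := s.ybar i) (g := g i)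
      (p := p i) rfl (z i)
  have inner_eq_sum (d : BlockVec N n) : ⟪g, d⟫_ℝ = ∑ i, ⟪g i, d i⟫_ℝ := PiLp.inner_apply g d
  have upper := H.le_quadratic s.ybar p
  have lower := add_inner_gradient_le_of_convexOn H.convex_smooth H.differentiable s.ybar z
  rw [← hg, inner_eq_sum] at upper lower
  simp only [Finset.sum_add_distrib, ← Finset.mul_sum] at block_le
  simp only [compositeObj, weightedSq, PiLp.sub_apply] at upper lower ⊢
  linarith

end IsCompositeProblem

theorem apgStep_t_sq_sub (s : APGState N n) :
    (apgStep h f L s).t ^ 2 - (apgStep h f L s).t = s.t ^ 2 := by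
  simp only [apgStep]
  have := Real.sq_sqrt (by positivity : 0 ≤ 1 + 4 * s.t ^ 2)
  nlinarith

theorem add_two_div_two_le_apg_t (y0 : BlockVec N n) (ℓ : ℕ) :
    ((ℓ : ℝ) + 2) / 2 ≤ (apg h f L y0 ℓ).t := by
  induction ℓ with
  | zero => simp [apg]
  | succ ℓ ih =>
    simp only [apg, apgStep]
    have : 2 * (apg h f L y0 ℓ).t ≤ Real.sqrt (1 + 4 * (apg h f L y0 ℓ).t ^ 2) :=
      Real.le_sqrt_of_sq_le (by nlinarith)
    push_cast
    linarith

/-- The point `t ȳ - (t - 1) y`, the centre of the quadratic term in `apgPotential`. -/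
def apgCenter (s : APGState N n) : BlockVec N n := s.t • s.ybar - (s.t - 1) • s.y

theorem apgCenter_apgStep (s : APGState N n) :
    apgCenter (apgStep h f L s) = s.t • (apgStep h f L s).y - (s.t - 1) • s.y := by
  set t' := (apgStep h f L s).t with ht'
  set p := (apgStep h f L s).y
  have t'_pos : 0 < t' := by simp only [ht', apgStep]; positivity
  have ybar_eq : (apgStep h f L s).ybar = p + ((s.t - 1) / t') • (p - s.y) := rfl
  rw [apgCenter, ybar_eq, smul_add, smul_smul, mul_div_cancel₀ _ t'_pos.ne']
  module

/-- The Lyapunov function of accelerated gradient methods, relative to a comparison point `z`. -/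
def apgPotential (h : Fin N → Vec n → ℝ) (f : BlockVec N n → ℝ) (L : Fin N → ℝ)
    (z : BlockVec N n) (s : APGState N n) : ℝ :=
  (s.t ^ 2 - s.t) * (compositeObj h f s.y - compositeObj h f z)
    + 1 / 2 * weightedSq L (apgCenter s - z)

namespace IsCompositeProblem

theorem apgPotential_apgStep_le (H : IsCompositeProblem h f L) (z : BlockVec N n)
    {s : APGState N n} (hs : 1 ≤ s.t) :
    apgPotential h f L z (apgStep h f L s) ≤ apgPotential h f L z s := by
  rw [apgPotential, apgPotential, apgStep_t_sq_sub, apgCenter_apgStep, apgCenter]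
  set t := s.t
  have t_pos : 0 < t := by linarith
  set p := (apgStep h f L s).y
  -- Comparing the step with `w` instead of `z` makes the two quadratic terms telescope.
  set w : BlockVec N n := (1 - 1 / t) • s.y + (1 / t) • z with hw
  have step_le := H.compositeObj_apgStep_le s w
  have convex_le : compositeObj h f w
      ≤ (1 - 1 / t) * compositeObj h f s.y + 1 / t * compositeObj h f z :=
    H.convexOn_compositeObj.2 (Set.mem_univ s.y) (Set.mem_univ z)
      (by rw [sub_nonneg, div_le_one t_pos]; exact hs) (by positivity) (by ring)
  have smul_w : t • w = (t - 1) • s.y + z := by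
    rw [hw, smul_add, smul_smul, smul_smul, mul_sub, mul_one_div_cancel t_pos.ne', mul_one,
      one_smul]
  have center_new : weightedSq L (t • p - (t - 1) • s.y - z) = t ^ 2 * weightedSq L (p - w) := by
    rw [← weightedSq_smul, smul_sub, smul_w, sub_sub]
  have center_old : weightedSq L (t • s.ybar - (t - 1) • s.y - z)
      = t ^ 2 * weightedSq L (w - s.ybar) := by
    rw [← neg_sq t, ← weightedSq_smul, neg_smul, ← smul_neg, neg_sub, smul_sub, smul_w, sub_sub]
  have scaled := mul_le_mul_of_nonneg_left
    (step_le.trans (add_le_add_left convex_le _)) (sq_nonneg t)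
  have average_mul : t ^ 2 * ((1 - 1 / t) * compositeObj h f s.y + 1 / t * compositeObj h f z)
      = (t ^ 2 - t) * compositeObj h f s.y + t * compositeObj h f z := by
    field_simp
  rw [center_new, center_old]
  linarith

theorem apgPotential_apg_le (H : IsCompositeProblem h f L) (y0 z : BlockVec N n) (ℓ : ℕ) :
    apgPotential h f L z (apg h f L y0 ℓ) ≤ 1 / 2 * weightedSq L (y0 - z) := by
  induction ℓ with
  | zero => simp [apg, apgPotential, apgCenter]
  | succ ℓ ih =>
    have := add_two_div_two_le_apg_t (h := h) (f := f) (L := L) y0 ℓ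
    have : (0 : ℝ) ≤ ℓ := ℓ.cast_nonneg
    exact (H.apgPotential_apgStep_le z (by linarith)).trans ih

theorem sq_mul_compositeObj_apg_sub_le (H : IsCompositeProblem h f L) (y0 z : BlockVec N n)
    (ℓ : ℕ) :
    ((ℓ : ℝ) + 2) ^ 2 * (compositeObj h f (apg h f L y0 (ℓ + 1)).y - compositeObj h f z)
      ≤ 2 * weightedSq L (y0 - z) := by
  have potential_le := H.apgPotential_apg_le y0 z (ℓ + 1)
  have t_sq : (apg h f L y0 (ℓ + 1)).t ^ 2 - (apg h f L y0 (ℓ + 1)).t = (apg h f L y0 ℓ).t ^ 2 :=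
    apgStep_t_sq_sub _
  rw [apgPotential, t_sq] at potential_le
  have weight_nonneg (i : Fin N) : 0 ≤ L i := (H.weight_pos i).le
  have := weightedSq_nonneg weight_nonneg (apgCenter (apg h f L y0 (ℓ + 1)) - z)
  have := weightedSq_nonneg weight_nonneg (y0 - z)
  set gap := compositeObj h f (apg h f L y0 (ℓ + 1)).y - compositeObj h f z
  rcases le_total gap 0 with gap_nonpos | gap_nonneg
  · linarith [mul_nonpos_of_nonneg_of_nonpos (sq_nonneg ((ℓ : ℝ) + 2)) gap_nonpos]
  · have t_sq_ge : ((ℓ : ℝ) + 2) ^ 2 ≤ 4 * (apg h f L y0 ℓ).t ^ 2 := by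
      have := pow_le_pow_left₀ (by positivity)
        (add_two_div_two_le_apg_t (h := h) (f := f) (L := L) y0 ℓ) 2
      linarith
    linarith [mul_le_mul_of_nonneg_right t_sq_ge gap_nonneg]

end IsCompositeProblem

end APG

/-! ### Singular values -/

section SingularValues

variable {E F : Type*} [NormedAddCommGroup E] [InnerProductSpace ℝ E] [FiniteDimensional ℝ E]
  [NormedAddCommGroup F] [InnerProductSpace ℝ F] [FiniteDimensional ℝ F] (T : E →ₗ[ℝ] F)

theorem sigmaMin_nonneg : 0 ≤ sigmaMin T := T.singularValues_nonneg _

theorem norm_sq_apply_eq_sum (x : E) :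
    ‖T x‖ ^ 2 = ∑ i : Fin (Module.finrank ℝ E), T.singularValues i ^ 2 *
      ((T.isSymmetric_adjoint_comp_self.eigenvectorBasis rfl).repr x i) ^ 2 := by
  set hT := T.isSymmetric_adjoint_comp_self
  set e := hT.eigenvectorBasis rfl
  have norm_sq : ‖T x‖ ^ 2 = ⟪(LinearMap.adjoint T ∘ₗ T) x, x⟫_ℝ := by
    rw [LinearMap.comp_apply, LinearMap.adjoint_inner_left, real_inner_self_eq_norm_sq]
  rw [norm_sq, ← e.repr.inner_map_map, PiLp.inner_apply]
  refine Finset.sum_congr rfl fun i _ => ?_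
  rw [hT.eigenvectorBasis_apply_self_apply rfl, T.sq_singularValues_fin rfl i]
  simp [e]
  ring

theorem norm_apply_eigenvectorBasis (i : Fin (Module.finrank ℝ E)) :
    ‖T (T.isSymmetric_adjoint_comp_self.eigenvectorBasis rfl i)‖ = T.singularValues i := by
  rw [← sq_eq_sq₀ (norm_nonneg _) (T.singularValues_nonneg _), norm_sq_apply_eq_sum,
    Finset.sum_eq_single i (fun j _ hj => by simp [hj]) (by simp)]
  simp

theorem norm_apply_le_sigmaMax (x : E) : ‖T x‖ ≤ sigmaMax T * ‖x‖ := by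
  refine le_of_sq_le_sq ?_ (mul_nonneg (T.singularValues_nonneg 0) (norm_nonneg _))
  rw [norm_sq_apply_eq_sum, mul_pow,
    ← (T.isSymmetric_adjoint_comp_self.eigenvectorBasis rfl).repr.norm_map x,
    EuclideanSpace.norm_sq_eq, Finset.mul_sum]
  refine Finset.sum_le_sum fun i _ => ?_
  rw [Real.norm_eq_abs, sq_abs]
  gcongr
  · exact T.singularValues_nonneg _
  · exact T.singularValues_antitone (Nat.zero_le _)

theorem sigmaMin_le_of_forall_norm_apply_le {M : ℝ} (hM : 0 ≤ M) (h : ∀ x, ‖T x‖ ≤ M * ‖x‖) :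
    sigmaMin T ≤ M := by
  refine (T.singularValues_antitone (Nat.zero_le _)).trans ?_
  rcases Nat.eq_zero_or_pos (Module.finrank ℝ E) with finrank_zero | finrank_pos
  · rwa [T.singularValues_of_finrank_le finrank_zero.le]
  · set e := T.isSymmetric_adjoint_comp_self.eigenvectorBasis rfl
    calc T.singularValues 0 = ‖T (e ⟨0, finrank_pos⟩)‖ :=
          (norm_apply_eigenvectorBasis T ⟨0, finrank_pos⟩).symm
      _ ≤ M * ‖e ⟨0, finrank_pos⟩‖ := h _
      _ = M := by rw [e.norm_eq_one, mul_one]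

section Wide

variable {T} (hd : Module.finrank ℝ F ≤ Module.finrank ℝ E)
include hd

theorem surjective_of_sigmaMin_pos (hpos : 0 < sigmaMin T) : Function.Surjective T := by
  rw [sigmaMin, min_eq_right hd, T.singularValues_pos_iff_lt_finrank_range] at hpos
  rw [← LinearMap.range_eq_top]
  exact Submodule.eq_top_of_finrank_eq (le_antisymm (Submodule.finrank_le _) (by omega))

theorem sigmaMin_mul_norm_le_of_mem_ker_orthogonal {x : E} (hx : x ∈ (LinearMap.ker T)ᗮ) :
    sigmaMin T * ‖x‖ ≤ ‖T x‖ := by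
  refine le_of_sq_le_sq ?_ (norm_nonneg _)
  set e := T.isSymmetric_adjoint_comp_self.eigenvectorBasis rfl
  rw [norm_sq_apply_eq_sum, mul_pow, ← e.repr.norm_map x, EuclideanSpace.norm_sq_eq,
    Finset.mul_sum]
  refine Finset.sum_le_sum fun i _ => ?_
  rw [Real.norm_eq_abs, sq_abs]
  by_cases hi : (i : ℕ) < Module.finrank ℝ F
  · gcongr
    · exact sigmaMin_nonneg T
    · rw [sigmaMin, min_eq_right hd]
      exact T.singularValues_antitone (by omega)
  · have singularValue_zero : T.singularValues i = 0 := by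
      rw [T.singularValues_eq_zero_iff_le_finrank_range]
      exact (Submodule.finrank_le _).trans (not_lt.1 hi)
    have mem_ker : e i ∈ LinearMap.ker T := by
      rw [LinearMap.mem_ker, ← norm_eq_zero, norm_apply_eigenvectorBasis, singularValue_zero]
    have repr_zero : e.repr x i = 0 := by
      rw [e.repr_apply_apply]
      exact (Submodule.mem_orthogonal _ x).1 hx _ mem_ker
    rw [repr_zero, zero_pow two_ne_zero, mul_zero]
    positivity

theorem exists_apply_eq_sigmaMin_mul_norm_le (hpos : 0 < sigmaMin T) (y : F) :
    ∃ x, T x = y ∧ sigmaMin T * ‖x‖ ≤ ‖y‖ := by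
  obtain ⟨x₀, rfl⟩ := surjective_of_sigmaMin_pos hd hpos y
  set K := LinearMap.ker T
  have apply_eq : T (x₀ - K.starProjection x₀) = T x₀ := by
    have : T (K.starProjection x₀) = 0 := (K.orthogonalProjectionOnto x₀).2
    rw [map_sub, this, sub_zero]
  exact ⟨x₀ - K.starProjection x₀, apply_eq, apply_eq ▸ sigmaMin_mul_norm_le_of_mem_ker_orthogonal
    hd (Submodule.sub_starProjection_mem_orthogonal x₀)⟩

end Wide

end SingularValues

/-! ### The problem and its subproblems -/

section BlockNorm

variable {N n : ℕ} (x : BlockVec N n)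

theorem norm_le_sum_norm_block : ‖x‖ ≤ ∑ i, ‖x i‖ := by
  refine le_of_sq_le_sq ?_ (Finset.sum_nonneg fun i _ => norm_nonneg _)
  rw [PiLp.norm_sq_eq_of_L2]
  exact Finset.sum_sq_le_sq_sum_of_nonneg fun i _ => norm_nonneg _

theorem sum_norm_block_le : ∑ i, ‖x i‖ ≤ Real.sqrt N * ‖x‖ := by
  refine le_of_sq_le_sq ?_ (by positivity)
  rw [mul_pow, Real.sq_sqrt N.cast_nonneg, PiLp.norm_sq_eq_of_L2]
  simpa using sq_sum_le_card_mul_sum_sq (s := Finset.univ) (f := fun i => ‖x i‖)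

end BlockNorm

theorem convexOn_half_mul_sq_norm_sub {E F : Type*} [AddCommGroup E] [Module ℝ E]
    [SeminormedAddCommGroup F] [NormedSpace ℝ F] (T : E →ₗ[ℝ] F) (v : F) :
    ConvexOn ℝ Set.univ fun x => 1 / 2 * ‖T x - v‖ ^ 2 := by
  have norm_convex : ConvexOn ℝ Set.univ fun x => ‖T x - v‖ := by
    simpa only [dist_eq_norm, Function.comp_def, Set.preimage_univ] using
      (convexOn_univ_dist v).comp_linearMap T
  exact (norm_convex.pow (fun x _ => norm_nonneg _) 2).smul (by norm_num : (0 : ℝ) ≤ 1 / 2)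

namespace Problem

variable {N n m : ℕ} {P : Problem N n m} {B τ G Lγ low : Fin N → ℝ}

theorem fullA_apply (x : BlockVec N n) : P.fullA x = ∑ i, P.A i (x i) := by
  simp [fullA]

theorem fullA_single (i : Fin N) (v : Vec n) : P.fullA (PiLp.single 2 i v) = P.A i v := by
  rw [fullA_apply, Finset.sum_eq_single i (fun j _ hj => by simp [hj]) (by simp)]
  simp

theorem convexOn_rhoBar (hρ : ∀ i, IsRegularizer (P.rho i) (B i) (τ i)) :
    ConvexOn ℝ Set.univ P.rhoBar :=
  convexOn_sum_block fun i => (hρ i).convex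

theorem convexOn_gammaBar (hγ : ∀ i, IsSmoothTerm (P.gamma i) (Lγ i) (low i)) :
    ConvexOn ℝ Set.univ P.gammaBar :=
  convexOn_sum_block fun i => (hγ i).convex

theorem convexOn_smoothPart (hγ : ∀ i, IsSmoothTerm (P.gamma i) (Lγ i) (low i)) {lam : ℝ}
    (hlam : 0 ≤ lam) (θ : Vec m) : ConvexOn ℝ Set.univ (P.smoothPart lam θ) :=
  (((convexOn_gammaBar hγ).smul hlam).add
    (convexOn_half_mul_sq_norm_sub P.fullA (P.b + lam • θ))).congr fun x _ => by
      simp only [smoothPart, Pi.add_apply, smul_eq_mul, sub_sub]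

theorem convexOn_subObj (hρ : ∀ i, IsRegularizer (P.rho i) (B i) (τ i))
    (hγ : ∀ i, IsSmoothTerm (P.gamma i) (Lγ i) (low i)) {lam : ℝ} (hlam : 0 ≤ lam) (θ : Vec m) :
    ConvexOn ℝ Set.univ (P.subObj lam θ) :=
  ((convexOn_rhoBar hρ).smul hlam).add (convexOn_smoothPart hγ hlam θ)

theorem continuous_F (hρ : ∀ i, IsRegularizer (P.rho i) (B i) (τ i))
    (hγ : ∀ i, IsSmoothTerm (P.gamma i) (Lγ i) (low i)) : Continuous P.F :=
  ((convexOn_rhoBar hρ).add (convexOn_gammaBar hγ)).locallyLipschitz.continuous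

theorem hasFDerivAt_gammaBar (hγ : ∀ i, IsSmoothTerm (P.gamma i) (Lγ i) (low i))
    (x : BlockVec N n) :
    HasFDerivAt P.gammaBar
      (∑ i, (fderiv ℝ (P.gamma i) (x i)).comp (PiLp.proj 2 (fun _ : Fin N => Vec n) i)) x :=
  HasFDerivAt.fun_sum (u := Finset.univ)
    (A := fun i => fun x : BlockVec N n => P.gamma i (x i)) (x := x)
    (A' := fun i => (fderiv ℝ (P.gamma i) (x i)).comp (PiLp.proj 2 (fun _ : Fin N => Vec n) i))
    fun i _ => ((hγ i).differentiable (x i)).hasFDerivAt.comp x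
      (PiLp.proj 2 (fun _ : Fin N => Vec n) i : BlockVec N n →L[ℝ] Vec n).hasFDerivAt

theorem hasFDerivAt_smoothPart (hγ : ∀ i, IsSmoothTerm (P.gamma i) (Lγ i) (low i)) (lam : ℝ)
    (θ : Vec m) (x : BlockVec N n) :
    HasFDerivAt (P.smoothPart lam θ)
      (lam • (∑ i, (fderiv ℝ (P.gamma i) (x i)).comp (PiLp.proj 2 (fun _ : Fin N => Vec n) i))
        + (1 / 2 : ℝ) • (2 • (innerSL ℝ (P.fullA x - P.b - lam • θ)).comp
            (LinearMap.toContinuousLinearMap P.fullA))) x := by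
  have residual : HasFDerivAt (fun x => P.fullA x - P.b - lam • θ)
      (LinearMap.toContinuousLinearMap P.fullA) x :=
    ((LinearMap.toContinuousLinearMap P.fullA).hasFDerivAt.sub_const P.b).sub_const (lam • θ)
  exact ((hasFDerivAt_gammaBar hγ x).const_mul lam).add (residual.norm_sq.const_mul (1 / 2))

theorem inner_gradient_smoothPart (hγ : ∀ i, IsSmoothTerm (P.gamma i) (Lγ i) (low i)) (lam : ℝ)
    (θ : Vec m) (x d : BlockVec N n) :
    ⟪gradient (P.smoothPart lam θ) x, d⟫_ℝ
      = lam * ∑ i, ⟪gradient (P.gamma i) (x i), d i⟫_ℝ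
        + ⟪P.fullA x - P.b - lam • θ, P.fullA d⟫_ℝ := by
  rw [inner_gradient_left, (hasFDerivAt_smoothPart hγ lam θ x).fderiv]
  rw [inner_sub_left, inner_sub_left, real_inner_smul_left]
  simp [inner_gradient_left]

theorem half_mul_sq_norm_residual (lam : ℝ) (θ : Vec m) (x z : BlockVec N n) :
    1 / 2 * ‖P.fullA z - P.b - lam • θ‖ ^ 2 = 1 / 2 * ‖P.fullA x - P.b - lam • θ‖ ^ 2
      + ⟪P.fullA x - P.b - lam • θ, P.fullA (z - x)⟫_ℝ + 1 / 2 * ‖P.fullA (z - x)‖ ^ 2 := by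
  have residual_eq :
      P.fullA z - P.b - lam • θ = (P.fullA x - P.b - lam • θ) + P.fullA (z - x) := by
    rw [map_sub]
    abel
  rw [residual_eq, norm_add_sq_real]
  ring

theorem smoothPart_le_quadratic (hγ : ∀ i, IsSmoothTerm (P.gamma i) (Lγ i) (low i)) {lam : ℝ}
    (hlam : 0 ≤ lam) (θ : Vec m) (x z : BlockVec N n) :
    P.smoothPart lam θ z ≤ P.smoothPart lam θ x + ⟪gradient (P.smoothPart lam θ) x, z - x⟫_ℝ
      + 1 / 2 * weightedSq (fun i => lam * Lγ i + sigmaMax P.fullA ^ 2) (z - x) := by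
  rw [inner_gradient_smoothPart hγ, smoothPart, half_mul_sq_norm_residual lam θ x z, smoothPart]
  have gamma_le : P.gammaBar z ≤ P.gammaBar x + ∑ i, ⟪gradient (P.gamma i) (x i), (z - x) i⟫_ℝ
      + ∑ i, Lγ i / 2 * ‖(z - x) i‖ ^ 2 := by
    rw [gammaBar, gammaBar, ← Finset.sum_add_distrib, ← Finset.sum_add_distrib]
    exact Finset.sum_le_sum fun i _ =>
      le_add_inner_gradient_add_sq_norm (hγ i).differentiable (hγ i).lipschitz (x i) (z i)
  have penalty_le : ‖P.fullA (z - x)‖ ^ 2 ≤ sigmaMax P.fullA ^ 2 * ∑ i, ‖(z - x) i‖ ^ 2 := by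
    rw [← PiLp.norm_sq_eq_of_L2, ← mul_pow]
    exact pow_le_pow_left₀ (norm_nonneg _) (norm_apply_le_sigmaMax _ _) 2
  have weight_split : 1 / 2 * weightedSq (fun i => lam * Lγ i + sigmaMax P.fullA ^ 2) (z - x)
      = lam * ∑ i, Lγ i / 2 * ‖(z - x) i‖ ^ 2
        + 1 / 2 * (sigmaMax P.fullA ^ 2 * ∑ i, ‖(z - x) i‖ ^ 2) := by
    simp only [weightedSq, Finset.mul_sum, ← Finset.sum_add_distrib]
    exact Finset.sum_congr rfl fun i _ => by ring
  linarith [mul_le_mul_of_nonneg_left gamma_le hlam]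

theorem isCompositeProblem_subproblem (hρ : ∀ i, IsRegularizer (P.rho i) (B i) (τ i))
    (hγ : ∀ i, IsSmoothTerm (P.gamma i) (Lγ i) (low i)) {lam : ℝ} (hlam : 0 ≤ lam) (θ : Vec m)
    (hL : ∀ i, 0 < lam * Lγ i + sigmaMax P.fullA ^ 2) :
    IsCompositeProblem (fun i z => lam * P.rho i z) (P.smoothPart lam θ)
      (fun i => lam * Lγ i + sigmaMax P.fullA ^ 2) where
  weight_pos := hL
  convex_block i := (hρ i).convex.smul hlam
  convex_smooth := convexOn_smoothPart hγ hlam θ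
  differentiable x := (hasFDerivAt_smoothPart hγ lam θ x).differentiableAt
  le_quadratic := smoothPart_le_quadratic hγ hlam θ

theorem compositeObj_eq_subObj (lam : ℝ) (θ : Vec m) (x : BlockVec N n) :
    compositeObj (fun i z => lam * P.rho i z) (P.smoothPart lam θ) x = P.subObj lam θ x := by
  rw [compositeObj, subObj, rhoBar, Finset.mul_sum]

theorem subObj_eq_mul_F_add_sq (lam : ℝ) (θ : Vec m) (x : BlockVec N n) :
    P.subObj lam θ x = lam * P.F x + 1 / 2 * ‖P.fullA x - P.b - lam • θ‖ ^ 2 := by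
  rw [subObj, smoothPart, F]
  ring

theorem F_add_le (hρ : ∀ i, IsRegularizer (P.rho i) (B i) (τ i))
    (hγ : ∀ i, IsSmoothTerm (P.gamma i) (Lγ i) (low i))
    (hG : ∀ i x, ‖gradient (P.gamma i) x‖ ≤ G i) (x d : BlockVec N n) :
    P.F (x + d) ≤ P.F x + (∑ i, (B i + G i)) * ‖d‖ := by
  rw [F, F, rhoBar, gammaBar, rhoBar, gammaBar, ← Finset.sum_add_distrib,
    ← Finset.sum_add_distrib, Finset.sum_mul, ← Finset.sum_add_distrib]
  refine Finset.sum_le_sum fun i _ => ?_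
  have block_le : ‖d i‖ ≤ ‖d‖ := PiLp.norm_apply_le d i
  have lip_nonneg : 0 ≤ B i + G i :=
    add_nonneg (hρ i).bound_pos.le ((norm_nonneg _).trans (hG i 0))
  have rho_le := (hρ i).sub_le ((x + d) i) (x i)
  have gamma_le := (hγ i).sub_le (hG i) ((x + d) i) (x i)
  rw [PiLp.add_apply, add_sub_cancel_left] at rho_le gamma_le
  rw [PiLp.add_apply]
  linarith [mul_le_mul_of_nonneg_left block_le lip_nonneg]

theorem sum_low_add_le_F (hρ : ∀ i, IsRegularizer (P.rho i) (B i) (τ i))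
    (hγ : ∀ i, IsSmoothTerm (P.gamma i) (Lγ i) (low i)) {t : ℝ} (ht0 : 0 ≤ t) (ht : ∀ i, t ≤ τ i)
    (x : BlockVec N n) : ∑ i, low i + t * ‖x‖ ≤ P.F x := by
  have rho_ge : t * ∑ i, ‖x i‖ ≤ P.rhoBar x := by
    rw [Finset.mul_sum]
    exact Finset.sum_le_sum fun i _ =>
      (mul_le_mul_of_nonneg_right (ht i) (norm_nonneg _)).trans ((hρ i).coercive _)
  have gamma_ge : ∑ i, low i ≤ P.gammaBar x := Finset.sum_le_sum fun i _ => (hγ i).lower _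
  rw [F]
  linarith [mul_le_mul_of_nonneg_left (norm_le_sum_norm_block x) ht0]

theorem isBounded_F_le (hρ : ∀ i, IsRegularizer (P.rho i) (B i) (τ i))
    (hγ : ∀ i, IsSmoothTerm (P.gamma i) (Lγ i) (low i)) (a : ℝ) :
    Bornology.IsBounded {x | P.F x ≤ a} := by
  obtain ⟨t, ht0, ht⟩ := Pi.exists_forall_pos_add_lt (x := 0) fun i => (hρ i).tau_pos
  simp only [Pi.zero_apply, zero_add] at ht
  refine (Metric.isBounded_closedBall (x := 0) (r := (a - ∑ i, low i) / t)).subset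
    fun x (hx : P.F x ≤ a) => ?_
  rw [mem_closedBall_zero_iff, le_div_iff₀ ht0]
  linarith [sum_low_add_le_F hρ hγ ht0.le (fun i => (ht i).le) x]

theorem exists_forall_subObj_le (hρ : ∀ i, IsRegularizer (P.rho i) (B i) (τ i))
    (hγ : ∀ i, IsSmoothTerm (P.gamma i) (Lγ i) (low i)) {lam : ℝ} (hlam : 0 < lam) (θ : Vec m) :
    ∃ x, ∀ z, P.subObj lam θ x ≤ P.subObj lam θ z := by
  refine (convexOn_subObj hρ hγ hlam.le θ).locallyLipschitz.continuous.exists_forall_le_of_isBounded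
    0 ((isBounded_F_le hρ hγ (P.subObj lam θ 0 / lam)).subset
      fun x (hx : P.subObj lam θ x ≤ P.subObj lam θ 0) => ?_)
  rw [Set.mem_ofPred_eq, le_div_iff₀ hlam]
  rw [subObj_eq_mul_F_add_sq] at hx
  linarith [sq_nonneg ‖P.fullA x - P.b - lam • θ‖]

theorem optVal_le (hρ : ∀ i, IsRegularizer (P.rho i) (B i) (τ i))
    (hγ : ∀ i, IsSmoothTerm (P.gamma i) (Lγ i) (low i)) {z : BlockVec N n}
    (hz : P.fullA z = P.b) : P.optVal ≤ P.F z := by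
  refine csInf_le ⟨∑ i, low i, ?_⟩ ⟨z, hz, rfl⟩
  rintro _ ⟨x, -, rfl⟩
  simpa using sum_low_add_le_F hρ hγ le_rfl (fun i => (hρ i).tau_pos.le) x

theorem exists_F_eq_optVal (hρ : ∀ i, IsRegularizer (P.rho i) (B i) (τ i))
    (hγ : ∀ i, IsSmoothTerm (P.gamma i) (Lγ i) (low i)) (hs : Function.Surjective P.fullA) :
    ∃ x, P.fullA x = P.b ∧ P.F x = P.optVal := by
  obtain ⟨x₀, hx₀⟩ := hs P.b
  have compact : IsCompact ({x | P.fullA x = P.b} ∩ {x | P.F x ≤ P.F x₀}) :=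
    Metric.isCompact_of_isClosed_isBounded
      ((isClosed_eq P.fullA.continuous_of_finiteDimensional continuous_const).inter
        (isClosed_le (continuous_F hρ hγ) continuous_const))
      ((isBounded_F_le hρ hγ _).subset Set.inter_subset_right)
  obtain ⟨x, ⟨feasible, below⟩, hx⟩ := compact.exists_isMinOn ⟨x₀, hx₀, le_refl (P.F x₀)⟩
    (continuous_F hρ hγ).continuousOn
  refine ⟨x, feasible, le_antisymm (le_csInf ⟨_, x₀, hx₀, rfl⟩ ?_) (optVal_le hρ hγ feasible)⟩
  rintro _ ⟨z, hz, rfl⟩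
  rcases le_total (P.F z) (P.F x₀) with h | h
  · exact hx ⟨hz, h⟩
  · exact le_trans below h

theorem minSigma_le (i : Fin N) : P.minSigma ≤ sigmaMin (P.A i) :=
  ciInf_le (Set.finite_range _).bddBelow i

theorem minSigma_pos [Nonempty (Fin N)] (h : ∀ i, 0 < sigmaMin (P.A i)) : 0 < P.minSigma := by
  obtain ⟨i, hi⟩ := exists_eq_ciInf_of_finite (f := fun i => sigmaMin (P.A i))
  rw [minSigma, ← hi]
  exact h i

theorem minSigma_le_sigmaMax [Nonempty (Fin N)] : P.minSigma ≤ sigmaMax P.fullA := by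
  obtain ⟨i⟩ := ‹Nonempty (Fin N)›
  refine (minSigma_le i).trans
    (sigmaMin_le_of_forall_norm_apply_le _ (P.fullA.singularValues_nonneg 0) fun v => ?_)
  rw [← fullA_single, ← PiLp.norm_single (p := 2) (fun _ : Fin N => Vec n) i v]
  exact norm_apply_le_sigmaMax _ _

theorem exists_fullA_eq_of_minSigma_le [Nonempty (Fin N)] (h : ∀ i, 0 < sigmaMin (P.A i))
    (hs : Function.Surjective P.fullA) {κ : ℝ} (hκ : P.minSigma ≤ κ * sigmaMin P.fullA)
    (y : Vec m) : ∃ d, P.fullA d = y ∧ P.minSigma * ‖d‖ ≤ κ * ‖y‖ := by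
  have product_pos : 0 < κ * sigmaMin P.fullA := (minSigma_pos h).trans_le hκ
  have κ_pos : 0 < κ := pos_of_mul_pos_left product_pos (sigmaMin_nonneg _)
  obtain ⟨d, hd, norm_d_le⟩ := exists_apply_eq_sigmaMin_mul_norm_le
    (LinearMap.finrank_le_finrank_of_surjective hs) (pos_of_mul_pos_right product_pos κ_pos.le) y
  refine ⟨d, hd, ?_⟩
  calc P.minSigma * ‖d‖ ≤ κ * sigmaMin P.fullA * ‖d‖ := by gcongr
    _ = κ * (sigmaMin P.fullA * ‖d‖) := mul_assoc _ _ _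
    _ ≤ κ * ‖y‖ := by gcongr

theorem exists_fullA_eq_of_le [Nonempty (Fin N)] (h : ∀ i, 0 < sigmaMin (P.A i)) (hmn : m ≤ n)
    (y : Vec m) : ∃ d, P.fullA d = y ∧ P.minSigma * ‖d‖ ≤ ‖y‖ := by
  obtain ⟨i⟩ := ‹Nonempty (Fin N)›
  obtain ⟨v, hv, norm_v_le⟩ := exists_apply_eq_sigmaMin_mul_norm_le (by simpa using hmn) (h i) y
  refine ⟨PiLp.single 2 i v, by rw [fullA_single, hv], ?_⟩
  rw [PiLp.norm_single]
  exact (mul_le_mul_of_nonneg_right (minSigma_le i) (norm_nonneg v)).trans norm_v_le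

theorem exists_fullA_eq [Nonempty (Fin N)] (h : ∀ i, 0 < sigmaMin (P.A i))
    (hs : Function.Surjective P.fullA) {κ : ℝ}
    (hκ : n < m → P.minSigma ≤ κ * sigmaMin P.fullA) (y : Vec m) :
    ∃ d, P.fullA d = y ∧ P.minSigma * ‖d‖ ≤ max 1 κ * ‖y‖ := by
  rcases lt_or_ge n m with hnm | hmn
  · obtain ⟨d, hd, norm_d_le⟩ := exists_fullA_eq_of_minSigma_le h hs (hκ hnm) y
    exact ⟨d, hd, norm_d_le.trans (by gcongr; exact le_max_right 1 κ)⟩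
  · obtain ⟨d, hd, norm_d_le⟩ := exists_fullA_eq_of_le h hmn y
    exact ⟨d, hd, norm_d_le.trans (le_mul_of_one_le_left (norm_nonneg y) (le_max_left 1 κ))⟩

end Problem

/-! ### Inexact minimizers of the subproblem -/

namespace Problem

variable {N n m : ℕ}

/-- `x` minimizes the subproblem up to the error `α + ξ ‖x - z‖` against every competitor `z`:
a common weakening of the two alternatives of `Accept`. -/
def IsApproxMin (P : Problem N n m) (lam α ξ : ℝ) (θ : Vec m) (x : BlockVec N n) : Prop :=
  ∀ z, P.subObj lam θ x ≤ P.subObj lam θ z + α + ξ * ‖x - z‖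

/-- The multiplier `θ - (A x - b) / λ` that DFAL computes from the approximate minimizer `x`. -/
def dualUpdate (P : Problem N n m) (lam : ℝ) (θ : Vec m) (x : BlockVec N n) : Vec m :=
  θ - (1 / lam) • (P.fullA x - P.b)

variable {P : Problem N n m} {B τ G Lγ low : Fin N → ℝ} {lam α ξ : ℝ} {θ : Vec m}
  {x z d : BlockVec N n}

theorem fullA_sub_eq_smul_sub_dualUpdate (hlam : lam ≠ 0) (θ : Vec m) (x : BlockVec N n) :
    P.fullA x - P.b = lam • (θ - P.dualUpdate lam θ x) := by
  rw [dualUpdate, sub_sub_cancel, smul_smul, mul_one_div_cancel hlam, one_smul]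

theorem dualUpdate_of_fullA_eq (hz : P.fullA z = P.b) : P.dualUpdate lam θ z = θ := by
  rw [dualUpdate, hz, sub_self, smul_zero, sub_zero]

theorem dualUpdate_add_smul (hlam : lam ≠ 0) (hd : P.fullA d = P.dualUpdate lam θ x) :
    P.dualUpdate lam θ (x + lam • d) = 0 := by
  rw [dualUpdate, map_add, map_smul, add_sub_right_comm, smul_add, smul_smul,
    one_div_mul_cancel hlam, one_smul, ← sub_sub, hd, dualUpdate, sub_self]

theorem subObj_eq_add_sq_dualUpdate (hlam : lam ≠ 0) (θ : Vec m) (x : BlockVec N n) :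
    P.subObj lam θ x = lam * P.F x + lam ^ 2 / 2 * ‖P.dualUpdate lam θ x‖ ^ 2 := by
  rw [subObj_eq_mul_F_add_sq, fullA_sub_eq_smul_sub_dualUpdate hlam θ x, ← smul_sub,
    sub_sub_cancel_left, norm_smul, norm_neg, mul_pow, Real.norm_eq_abs, sq_abs]
  ring

theorem inner_le_mul_norm_of_norm_block_le {g d : BlockVec N n} (hξ : 0 ≤ ξ)
    (hg : ∀ i, ‖g i‖ ≤ ξ / Real.sqrt N) : ⟪g, d⟫_ℝ ≤ ξ * ‖d‖ := by
  have sum_le : ⟪g, d⟫_ℝ ≤ ξ / Real.sqrt N * ∑ i, ‖d i‖ := by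
    rw [PiLp.inner_apply, Finset.mul_sum]
    exact Finset.sum_le_sum fun i _ => (real_inner_le_norm _ _).trans (by gcongr; exact hg i)
  calc ⟪g, d⟫_ℝ ≤ ξ / Real.sqrt N * ∑ i, ‖d i‖ := sum_le
    _ ≤ ξ / Real.sqrt N * (Real.sqrt N * ‖d‖) := by gcongr; exact sum_norm_block_le d
    _ = ξ * (Real.sqrt N / Real.sqrt N) * ‖d‖ := by ring
    _ ≤ ξ * ‖d‖ := by gcongr; exact mul_le_of_le_one_right hξ (div_self_le_one _)

theorem rhoBar_add_inner_le {q : BlockVec N n} (hq : ∀ i, IsSubgradient (P.rho i) (x i) (q i))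
    (z : BlockVec N n) : P.rhoBar x + ⟪q, z - x⟫_ℝ ≤ P.rhoBar z := by
  rw [rhoBar, rhoBar, PiLp.inner_apply, ← Finset.sum_add_distrib]
  exact Finset.sum_le_sum fun i _ => hq i (z i)

theorem Accept.isApproxMin (hγ : ∀ i, IsSmoothTerm (P.gamma i) (Lγ i) (low i)) (hlam : 0 ≤ lam)
    (hα : 0 ≤ α) (hξ : 0 ≤ ξ) (h : P.Accept lam α ξ θ x) : P.IsApproxMin lam α ξ θ x := by
  intro z
  rcases h with value_le | ⟨q, hq⟩
  · linarith [value_le z, mul_nonneg hξ (norm_nonneg (x - z))]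
  · have smooth_ge := add_inner_gradient_le_of_convexOn (convexOn_smoothPart hγ hlam θ)
      (fun x => (hasFDerivAt_smoothPart hγ lam θ x).differentiableAt) x z
    have rho_ge := mul_le_mul_of_nonneg_left
      (rhoBar_add_inner_le (q := WithLp.toLp 2 q) (fun i => (hq i).1) z) hlam
    have residual_le := inner_le_mul_norm_of_norm_block_le
      (g := lam • WithLp.toLp 2 q + gradient (P.smoothPart lam θ) x) (d := x - z) hξ
      fun i => (hq i).2
    rw [inner_add_left, real_inner_smul_left] at residual_le
    rw [← neg_sub x z, inner_neg_right] at smooth_ge rho_ge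
    rw [subObj, subObj]
    linarith

theorem IsApproxMin.F_sub_add_sq_le (hlam : 0 < lam) (h : P.IsApproxMin lam α ξ θ x)
    (hz : P.fullA z = P.b) :
    P.F x - P.F z + lam / 2 * ‖P.dualUpdate lam θ x‖ ^ 2
      ≤ lam / 2 * ‖θ‖ ^ 2 + α / lam + ξ / lam * ‖x - z‖ := by
  have compare := h z
  rw [subObj_eq_add_sq_dualUpdate hlam.ne', subObj_eq_add_sq_dualUpdate hlam.ne',
    dualUpdate_of_fullA_eq hz] at compare
  refine le_of_mul_le_mul_left ?_ hlam
  calc lam * (P.F x - P.F z + lam / 2 * ‖P.dualUpdate lam θ x‖ ^ 2)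
      ≤ lam ^ 2 / 2 * ‖θ‖ ^ 2 + α + ξ * ‖x - z‖ := by linarith
    _ = lam * (lam / 2 * ‖θ‖ ^ 2 + α / lam + ξ / lam * ‖x - z‖) := by field_simp

theorem IsApproxMin.mul_norm_add_sq_le (hρ : ∀ i, IsRegularizer (P.rho i) (B i) (τ i))
    (hγ : ∀ i, IsSmoothTerm (P.gamma i) (Lγ i) (low i)) (hlam : 0 < lam) (hξ : 0 ≤ ξ) {δ : ℝ}
    (hδ : 0 ≤ δ) (hτ : ∀ i, ξ / lam + δ ≤ τ i) (h : P.IsApproxMin lam α ξ θ x)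
    (hz : P.fullA z = P.b) :
    δ * ‖x‖ + lam / 2 * ‖P.dualUpdate lam θ x‖ ^ 2
      ≤ 2 * (P.F z - ∑ i, low i) + α / lam + lam / 2 * ‖θ‖ ^ 2 := by
  have slope_nonneg : 0 ≤ ξ / lam := div_nonneg hξ hlam.le
  have F_x_ge := sum_low_add_le_F hρ hγ (add_nonneg slope_nonneg hδ) hτ x
  have F_z_ge := sum_low_add_le_F hρ hγ slope_nonneg
    (fun i => (le_add_of_nonneg_right hδ).trans (hτ i)) z
  have distance_le := mul_le_mul_of_nonneg_left (norm_sub_le x z) slope_nonneg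
  linarith [h.F_sub_add_sq_le hlam hz]

theorem IsApproxMin.half_sq_norm_dualUpdate_le (hρ : ∀ i, IsRegularizer (P.rho i) (B i) (τ i))
    (hγ : ∀ i, IsSmoothTerm (P.gamma i) (Lγ i) (low i))
    (hG : ∀ i x, ‖gradient (P.gamma i) x‖ ≤ G i) (hlam : 0 < lam)
    (h : P.IsApproxMin lam α ξ θ x) (hd : P.fullA d = P.dualUpdate lam θ x) :
    1 / 2 * ‖P.dualUpdate lam θ x‖ ^ 2
      ≤ α / lam ^ 2 + (ξ / lam + ∑ i, (B i + G i)) * ‖d‖ := by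
  -- The competitor `x + λ d` cancels the penalty term at the price of a Lipschitz term.
  have compare := h (x + lam • d)
  rw [subObj_eq_add_sq_dualUpdate hlam.ne', subObj_eq_add_sq_dualUpdate hlam.ne',
    dualUpdate_add_smul hlam.ne' hd, norm_zero, sub_add_cancel_left, norm_neg] at compare
  have F_le := mul_le_mul_of_nonneg_left (F_add_le hρ hγ hG x (lam • d)) hlam.le
  rw [norm_smul, Real.norm_of_nonneg hlam.le] at compare F_le
  refine le_of_mul_le_mul_left ?_ (pow_pos hlam 2)
  calc lam ^ 2 * (1 / 2 * ‖P.dualUpdate lam θ x‖ ^ 2)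
      ≤ α + ξ * (lam * ‖d‖) + lam * ((∑ i, (B i + G i)) * (lam * ‖d‖)) := by linarith
    _ = lam ^ 2 * (α / lam ^ 2 + (ξ / lam + ∑ i, (B i + G i)) * ‖d‖) := by
      field_simp
      ring

theorem succ_mem_acceptedCounts (hρ : ∀ i, IsRegularizer (P.rho i) (B i) (τ i))
    (hγ : ∀ i, IsSmoothTerm (P.gamma i) (Lγ i) (low i)) {st : State N n m} (hlam : 0 ≤ st.lam)
    (hL : ∀ i, 0 < st.lam * Lγ i + sigmaMax P.fullA ^ 2) {M : ℝ}
    (hM : ∀ i, st.lam * Lγ i + sigmaMax P.fullA ^ 2 ≤ M)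
    (hz : ∀ w, P.subObj st.lam st.θ z ≤ P.subObj st.lam st.θ w) {ℓ : ℕ}
    (hℓ : 2 * (M * ‖st.x - z‖ ^ 2) ≤ (ℓ + 2) ^ 2 * st.α) :
    ℓ + 1 ∈ P.acceptedCounts Lγ st := by
  refine ⟨Nat.le_add_left 1 ℓ, Or.inl fun w => ?_⟩
  have rate := (isCompositeProblem_subproblem hρ hγ hlam st.θ hL).sq_mul_compositeObj_apg_sub_le
    st.x z ℓ
  rw [compositeObj_eq_subObj, compositeObj_eq_subObj] at rate
  have subopt_le := le_of_mul_le_mul_left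
    ((rate.trans (mul_le_mul_of_nonneg_left (weightedSq_le hM _) zero_le_two)).trans hℓ)
    (by positivity)
  exact (sub_le_sub_left (hz w) _).trans subopt_le

end Problem

/-! ### Bounds along the outer iteration -/

theorem div_sq_mul_le_div {a l u : ℝ} (ha : 0 ≤ a) (hu : 0 < u) (hl : l ≤ u) :
    a / u ^ 2 * l ≤ a / u := by
  calc a / u ^ 2 * l ≤ a / u ^ 2 * u := by gcongr
    _ = a / u := by field_simp

theorem le_of_half_sq_le_add_mul {a w u : ℝ} (ha : 0 ≤ a) (hw : 0 ≤ w)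
    (h : 1 / 2 * u ^ 2 ≤ a + w * u) : u ≤ 2 * w + 2 * a + 1 := by
  by_contra! hu
  nlinarith

/-- The quantities on which the constants of the complexity bounds may depend, with a margin `δ` in
`ξ⁽¹⁾ / λ⁽¹⁾ < min τᵢ`. -/
structure Params (N : ℕ) where
  (τ B G Lγ : Fin N → ℝ)
  (c lam1 α1 ξ1 D s κ δ : ℝ)
  c_pos : 0 < c
  c_lt_one : c < 1
  lam1_pos : 0 < lam1
  α1_pos : 0 < α1
  ξ1_pos : 0 < ξ1
  s_pos : 0 < s
  δ_pos : 0 < δ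
  slope_add_le : ∀ i, ξ1 / lam1 + δ ≤ τ i

namespace Params

variable {N n m : ℕ} (p : Params N)

/-- The assumptions on the problem `P` and on the starting point `x0` under which the complexity
bounds with the constants of `p` hold. -/
structure Admits (P : Problem N n m) (low : Fin N → ℝ) (x0 : BlockVec N n) : Prop where
  rho : ∀ i, IsRegularizer (P.rho i) (p.B i) (p.τ i)
  gamma : ∀ i, IsSmoothTerm (P.gamma i) (p.Lγ i) (low i)
  norm_gradient_le : ∀ i x, ‖gradient (P.gamma i) x‖ ≤ p.G i
  surjective : Function.Surjective P.fullA
  sigmaMin_pos : ∀ i, 0 < sigmaMin (P.A i)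
  s_le : p.s ≤ sigmaMax P.fullA
  minSigma_le : n < m → P.minSigma ≤ p.κ * sigmaMin P.fullA
  gap_le : P.optVal - ∑ i, low i ≤ p.D
  norm_x0_le : ‖x0‖ ≤ p.D

/-- A Lipschitz constant of the objective `F`. -/
def lip : ℝ := ∑ i, (p.B i + p.G i)

/-- The constant `W` for which every `y` has a preimage under `A` of norm at most `W Θ ‖y‖`. -/
def preimageConst : ℝ := max 1 p.κ / p.s

/-- The right-hand side, up to the energy of the multiplier, of the coercivity estimate. -/
def gapConst : ℝ := 2 * p.D + p.α1 / p.lam1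

/-- A bound for the energy `λ ‖θ‖²`. -/
def dualEnergy : ℝ := 2 * p.gapConst / (1 - p.c)

/-- A bound for the norms of the outer iterates and of the minimizers of the subproblems. -/
def radius : ℝ := (p.gapConst + p.dualEnergy / 2) / p.δ + p.D

/-- The constant `T` in `‖θ‖ ≤ T Θ`. -/
def dualConst : ℝ :=
  2 * ((p.ξ1 / p.lam1 + p.lip) * p.preimageConst) + 2 * (p.α1 / p.lam1 ^ 2) + 1

/-- The constant `O` in `|F x - F*| ≤ O Θ² λ`. -/
def optConst : ℝ :=
  p.dualConst ^ 2 / 2 + p.α1 / p.lam1 ^ 2 + 2 * (p.ξ1 / p.lam1 ^ 2) * p.radius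
    + 2 * p.dualConst * p.lip * p.preimageConst

/-- The constant `H` for which the weights of MS-APG are at most `H σ_max(A)²`. -/
def weightConst : ℝ := p.lam1 * (⨆ i, p.Lγ i) / p.s ^ 2 + 1

/-- The constant `E` in `N⁽ᵏ⁾ ≤ E σ_max(A) / λ⁽ᵏ⁾`. -/
def countConst : ℝ :=
  Real.sqrt (8 * p.weightConst * p.radius ^ 2 / (p.α1 / p.lam1 ^ 2)) + 2 * p.lam1 / p.s

/-- The invariants of the outer iteration. -/
structure Controlled (P : Problem N n m) (st : State N n m) : Prop where
  lam_pos : 0 < st.lam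
  lam_le : st.lam ≤ p.lam1
  α_eq : st.α = p.α1 / p.lam1 ^ 2 * st.lam ^ 2
  ξ_eq : st.ξ = p.ξ1 / p.lam1 ^ 2 * st.lam ^ 2
  energy_le : st.lam * ‖st.θ‖ ^ 2 ≤ p.dualEnergy
  norm_θ_le : ‖st.θ‖ ≤ p.dualConst * P.Theta
  norm_x_le : ‖st.x‖ ≤ p.radius

variable {p} {P : Problem N n m} {low : Fin N → ℝ} {x0 : BlockVec N n} {st : State N n m}

namespace Admits

theorem sigmaMax_pos (h : p.Admits P low x0) : 0 < sigmaMax P.fullA := p.s_pos.trans_le h.s_le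

theorem nontrivial_blockVec (h : p.Admits P low x0) : Nontrivial (BlockVec N n) := by
  by_contra trivial
  refine h.sigmaMax_pos.ne' (P.fullA.singularValues_of_finrank_le (Nat.le_zero.2 ?_))
  exact Module.finrank_zero_iff.2 (not_nontrivial_iff_subsingleton.1 trivial)

theorem nonempty_fin (h : p.Admits P low x0) : Nonempty (Fin N) := by
  by_contra empty
  rw [not_nonempty_iff] at empty
  obtain ⟨x, y, hxy⟩ := h.nontrivial_blockVec
  exact hxy (PiLp.ext fun i => isEmptyElim i)

theorem nontrivial_vec (h : p.Admits P low x0) : Nontrivial (Vec n) := by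
  by_contra trivial
  rw [not_nontrivial_iff_subsingleton] at trivial
  obtain ⟨x, y, hxy⟩ := h.nontrivial_blockVec
  exact hxy (PiLp.ext fun i => Subsingleton.elim _ _)

theorem Lγ_nonneg (h : p.Admits P low x0) (i : Fin N) : 0 ≤ p.Lγ i := by
  obtain ⟨x, y, hxy⟩ := h.nontrivial_vec
  exact nonneg_of_mul_nonneg_left ((norm_nonneg _).trans ((h.gamma i).lipschitz x y))
    (norm_sub_pos_iff.2 hxy)

theorem D_nonneg (h : p.Admits P low x0) : 0 ≤ p.D := (norm_nonneg _).trans h.norm_x0_le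

theorem lip_nonneg (h : p.Admits P low x0) : 0 ≤ p.lip :=
  Finset.sum_nonneg fun i _ => add_nonneg (h.rho i).bound_pos.le
    ((norm_nonneg _).trans (h.norm_gradient_le i 0))

theorem minSigma_pos (h : p.Admits P low x0) : 0 < P.minSigma :=
  have := h.nonempty_fin
  Problem.minSigma_pos h.sigmaMin_pos

theorem one_le_Theta (h : p.Admits P low x0) : 1 ≤ P.Theta :=
  have := h.nonempty_fin
  (one_le_div h.minSigma_pos).2 Problem.minSigma_le_sigmaMax

end Admits

theorem preimageConst_nonneg : 0 ≤ p.preimageConst :=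
  div_nonneg (zero_le_one.trans (le_max_left 1 p.κ)) p.s_pos.le

theorem gapConst_nonneg (hD : 0 ≤ p.D) : 0 ≤ p.gapConst :=
  add_nonneg (mul_nonneg zero_le_two hD) (div_pos p.α1_pos p.lam1_pos).le

theorem dualEnergy_nonneg (hD : 0 ≤ p.D) : 0 ≤ p.dualEnergy :=
  div_nonneg (mul_nonneg zero_le_two (gapConst_nonneg hD)) (sub_pos.2 p.c_lt_one).le

theorem D_le_radius (hD : 0 ≤ p.D) : p.D ≤ p.radius :=
  le_add_of_nonneg_left (div_nonneg
    (add_nonneg (gapConst_nonneg hD) (div_nonneg (dualEnergy_nonneg hD) zero_le_two)) p.δ_pos.le)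

theorem gapConst_add_le_mul_radius (hD : 0 ≤ p.D) :
    p.gapConst + p.dualEnergy / 2 ≤ p.δ * p.radius := by
  rw [radius, mul_add, mul_div_cancel₀ _ p.δ_pos.ne']
  exact le_add_of_nonneg_right (mul_nonneg p.δ_pos.le hD)

theorem one_le_dualConst (hlip : 0 ≤ p.lip) : 1 ≤ p.dualConst := by
  have := p.ξ1_pos
  have := p.lam1_pos
  have := p.α1_pos
  have := p.preimageConst_nonneg
  exact le_add_of_nonneg_left (by positivity)

theorem optConst_nonneg (hD : 0 ≤ p.D) (hlip : 0 ≤ p.lip) : 0 ≤ p.optConst := by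
  have := p.ξ1_pos
  have := p.lam1_pos
  have := p.α1_pos
  have := p.preimageConst_nonneg
  have := zero_le_one.trans (one_le_dualConst hlip)
  have := hD.trans (D_le_radius hD)
  unfold optConst
  positivity

theorem countConst_nonneg : 0 ≤ p.countConst :=
  add_nonneg (Real.sqrt_nonneg _) (div_pos (mul_pos two_pos p.lam1_pos) p.s_pos).le

theorem weightConst_pos (hΛ : 0 ≤ ⨆ i, p.Lγ i) : 0 < p.weightConst :=
  add_pos_of_nonneg_of_pos (div_nonneg (mul_nonneg p.lam1_pos.le hΛ) (sq_nonneg _)) one_pos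

theorem Admits.exists_fullA_eq (h : p.Admits P low x0) (y : Vec m) :
    ∃ d, P.fullA d = y ∧ ‖d‖ ≤ p.preimageConst * P.Theta * ‖y‖ := by
  have := h.nonempty_fin
  have μ_pos := h.minSigma_pos
  obtain ⟨d, hd, norm_d_le⟩ :=
    Problem.exists_fullA_eq h.sigmaMin_pos h.surjective h.minSigma_le y
  refine ⟨d, hd, ?_⟩
  calc ‖d‖ ≤ max 1 p.κ * ‖y‖ / P.minSigma := (le_div_iff₀' μ_pos).2 norm_d_le
    _ ≤ max 1 p.κ * ‖y‖ / P.minSigma * (sigmaMax P.fullA / p.s) :=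
      le_mul_of_one_le_right (by positivity) ((one_le_div p.s_pos).2 h.s_le)
    _ = p.preimageConst * P.Theta * ‖y‖ := by
      rw [preimageConst, Problem.Theta]
      ring

theorem Admits.norm_le_radius_of_F_eq_optVal (h : p.Admits P low x0) {z : BlockVec N n}
    (hz : P.F z = P.optVal) : ‖z‖ ≤ p.radius := by
  have coercive := Problem.sum_low_add_le_F h.rho h.gamma p.δ_pos.le (fun i =>
    (le_add_of_nonneg_left (div_pos p.ξ1_pos p.lam1_pos).le).trans (p.slope_add_le i)) z
  have slack_nonneg : 0 ≤ p.α1 / p.lam1 := (div_pos p.α1_pos p.lam1_pos).le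
  have gap_add_le := gapConst_add_le_mul_radius h.D_nonneg
  rw [gapConst] at gap_add_le
  refine le_of_mul_le_mul_left ?_ p.δ_pos
  linarith [h.gap_le, h.D_nonneg, dualEnergy_nonneg h.D_nonneg]

namespace Controlled

theorem α_div_lam (hst : p.Controlled P st) : st.α / st.lam = p.α1 / p.lam1 ^ 2 * st.lam := by
  have := hst.lam_pos
  rw [hst.α_eq]
  field_simp

theorem ξ_div_lam (hst : p.Controlled P st) : st.ξ / st.lam = p.ξ1 / p.lam1 ^ 2 * st.lam := by
  have := hst.lam_pos
  rw [hst.ξ_eq]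
  field_simp

theorem α_div_lam_le (hst : p.Controlled P st) : st.α / st.lam ≤ p.α1 / p.lam1 :=
  hst.α_div_lam.trans_le (div_sq_mul_le_div p.α1_pos.le p.lam1_pos hst.lam_le)

theorem ξ_div_lam_le (hst : p.Controlled P st) : st.ξ / st.lam ≤ p.ξ1 / p.lam1 :=
  hst.ξ_div_lam.trans_le (div_sq_mul_le_div p.ξ1_pos.le p.lam1_pos hst.lam_le)

theorem α_pos (hst : p.Controlled P st) : 0 < st.α := by
  rw [hst.α_eq]
  exact mul_pos (div_pos p.α1_pos (pow_pos p.lam1_pos 2)) (pow_pos hst.lam_pos 2)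

theorem ξ_nonneg (hst : p.Controlled P st) : 0 ≤ st.ξ := by
  rw [hst.ξ_eq]
  exact mul_nonneg (div_pos p.ξ1_pos (pow_pos p.lam1_pos 2)).le (sq_nonneg _)

section Accepted

variable {x : BlockVec N n}

theorem isApproxMin (hst : p.Controlled P st) (h : p.Admits P low x0)
    (hx : P.Accept st.lam st.α st.ξ st.θ x) : P.IsApproxMin st.lam st.α st.ξ st.θ x :=
  hx.isApproxMin h.gamma hst.lam_pos.le hst.α_pos.le hst.ξ_nonneg

theorem mul_norm_add_energy_le (hst : p.Controlled P st) (h : p.Admits P low x0)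
    (hx : P.Accept st.lam st.α st.ξ st.θ x) :
    p.δ * ‖x‖ + st.lam / 2 * ‖P.dualUpdate st.lam st.θ x‖ ^ 2
      ≤ p.gapConst + p.dualEnergy / 2 := by
  obtain ⟨z, hz, F_z⟩ := Problem.exists_F_eq_optVal h.rho h.gamma h.surjective
  have coercive := (hst.isApproxMin h hx).mul_norm_add_sq_le h.rho h.gamma hst.lam_pos
    hst.ξ_nonneg p.δ_pos.le
    (fun i => (add_le_add_left hst.ξ_div_lam_le p.δ).trans (p.slope_add_le i)) hz
  rw [gapConst]
  linarith [h.gap_le, hst.α_div_lam_le, hst.energy_le]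

theorem norm_le_radius (hst : p.Controlled P st) (h : p.Admits P low x0)
    (hx : P.Accept st.lam st.α st.ξ st.θ x) : ‖x‖ ≤ p.radius := by
  have energy_nonneg : 0 ≤ st.lam / 2 * ‖P.dualUpdate st.lam st.θ x‖ ^ 2 :=
    mul_nonneg (half_pos hst.lam_pos).le (sq_nonneg _)
  refine le_of_mul_le_mul_left ?_ p.δ_pos
  linarith [hst.mul_norm_add_energy_le h hx, gapConst_add_le_mul_radius h.D_nonneg]

theorem energy_dualUpdate_le (hst : p.Controlled P st) (h : p.Admits P low x0)
    (hx : P.Accept st.lam st.α st.ξ st.θ x) :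
    p.c * st.lam * ‖P.dualUpdate st.lam st.θ x‖ ^ 2 ≤ p.dualEnergy := by
  have energy_le : st.lam * ‖P.dualUpdate st.lam st.θ x‖ ^ 2
      ≤ 2 * p.gapConst + p.dualEnergy := by
    linarith [hst.mul_norm_add_energy_le h hx, mul_nonneg p.δ_pos.le (norm_nonneg x)]
  have fixed_point : p.dualEnergy * (1 - p.c) = 2 * p.gapConst :=
    div_mul_cancel₀ _ (sub_pos.2 p.c_lt_one).ne'
  calc p.c * st.lam * ‖P.dualUpdate st.lam st.θ x‖ ^ 2
      = p.c * (st.lam * ‖P.dualUpdate st.lam st.θ x‖ ^ 2) := mul_assoc _ _ _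
    _ ≤ p.c * (2 * p.gapConst + p.dualEnergy) :=
      mul_le_mul_of_nonneg_left energy_le p.c_pos.le
    _ ≤ 2 * p.gapConst + p.c * p.dualEnergy := by
      linarith [mul_le_of_le_one_left (mul_nonneg zero_le_two (gapConst_nonneg h.D_nonneg))
        p.c_lt_one.le]
    _ = p.dualEnergy := by linarith

theorem norm_dualUpdate_le (hst : p.Controlled P st) (h : p.Admits P low x0)
    (hx : P.Accept st.lam st.α st.ξ st.θ x) :
    ‖P.dualUpdate st.lam st.θ x‖ ≤ p.dualConst * P.Theta := by
  obtain ⟨d, hd, norm_d_le⟩ := h.exists_fullA_eq (P.dualUpdate st.lam st.θ x)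
  have Theta_ge := h.one_le_Theta
  have a_nonneg : 0 ≤ p.α1 / p.lam1 ^ 2 := (div_pos p.α1_pos (pow_pos p.lam1_pos 2)).le
  have slope_nonneg : 0 ≤ p.ξ1 / p.lam1 + p.lip :=
    add_nonneg (div_pos p.ξ1_pos p.lam1_pos).le h.lip_nonneg
  have W_nonneg := p.preimageConst_nonneg
  have α_div_sq : st.α / st.lam ^ 2 = p.α1 / p.lam1 ^ 2 := by
    rw [hst.α_eq, mul_div_cancel_right₀ _ (pow_pos hst.lam_pos 2).ne']
  have quadratic : 1 / 2 * ‖P.dualUpdate st.lam st.θ x‖ ^ 2 ≤ p.α1 / p.lam1 ^ 2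
      + (p.ξ1 / p.lam1 + p.lip) * p.preimageConst * P.Theta
        * ‖P.dualUpdate st.lam st.θ x‖ := by
    calc 1 / 2 * ‖P.dualUpdate st.lam st.θ x‖ ^ 2
        ≤ st.α / st.lam ^ 2 + (st.ξ / st.lam + p.lip) * ‖d‖ :=
          (hst.isApproxMin h hx).half_sq_norm_dualUpdate_le h.rho h.gamma h.norm_gradient_le
            hst.lam_pos hd
      _ ≤ p.α1 / p.lam1 ^ 2 + (p.ξ1 / p.lam1 + p.lip)
          * (p.preimageConst * P.Theta * ‖P.dualUpdate st.lam st.θ x‖) := by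
        rw [α_div_sq]
        exact add_le_add_right (mul_le_mul (add_le_add_left hst.ξ_div_lam_le _) norm_d_le
          (norm_nonneg d) slope_nonneg) _
      _ = _ := by ring
  calc ‖P.dualUpdate st.lam st.θ x‖
      ≤ 2 * ((p.ξ1 / p.lam1 + p.lip) * p.preimageConst * P.Theta)
        + 2 * (p.α1 / p.lam1 ^ 2) + 1 :=
        le_of_half_sq_le_add_mul a_nonneg (by positivity) quadratic
    _ ≤ 2 * ((p.ξ1 / p.lam1 + p.lip) * p.preimageConst * P.Theta)
        + 2 * (p.α1 / p.lam1 ^ 2 * P.Theta) + P.Theta := by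
      linarith [le_mul_of_one_le_right a_nonneg Theta_ge]
    _ = p.dualConst * P.Theta := by
      rw [dualConst]
      ring

theorem norm_residual_le (hst : p.Controlled P st) (h : p.Admits P low x0)
    (hx : P.Accept st.lam st.α st.ξ st.θ x) :
    ‖P.fullA x - P.b‖ ≤ 2 * p.dualConst * P.Theta * st.lam := by
  calc ‖P.fullA x - P.b‖ = st.lam * ‖st.θ - P.dualUpdate st.lam st.θ x‖ := by
        rw [Problem.fullA_sub_eq_smul_sub_dualUpdate hst.lam_pos.ne' st.θ x, norm_smul,
          Real.norm_of_nonneg hst.lam_pos.le]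
    _ ≤ st.lam * (p.dualConst * P.Theta + p.dualConst * P.Theta) :=
      mul_le_mul_of_nonneg_left ((norm_sub_le _ _).trans
        (add_le_add hst.norm_θ_le (hst.norm_dualUpdate_le h hx))) hst.lam_pos.le
    _ = 2 * p.dualConst * P.Theta * st.lam := by ring

theorem F_sub_optVal_le (hst : p.Controlled P st) (h : p.Admits P low x0)
    (hx : P.Accept st.lam st.α st.ξ st.θ x) :
    P.F x - P.optVal ≤ (p.dualConst ^ 2 / 2 + p.α1 / p.lam1 ^ 2
      + 2 * (p.ξ1 / p.lam1 ^ 2) * p.radius) * P.Theta ^ 2 * st.lam := by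
  obtain ⟨z, hz, F_z⟩ := Problem.exists_F_eq_optVal h.rho h.gamma h.surjective
  have lam_pos := hst.lam_pos
  have a_nonneg : 0 ≤ p.α1 / p.lam1 ^ 2 := (div_pos p.α1_pos (pow_pos p.lam1_pos 2)).le
  have e_nonneg : 0 ≤ p.ξ1 / p.lam1 ^ 2 := (div_pos p.ξ1_pos (pow_pos p.lam1_pos 2)).le
  have R_nonneg : 0 ≤ p.radius := h.D_nonneg.trans (D_le_radius h.D_nonneg)
  have distance_le : ‖x - z‖ ≤ 2 * p.radius := by
    linarith [norm_sub_le x z, hst.norm_le_radius h hx, h.norm_le_radius_of_F_eq_optVal F_z]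
  have value_le := (hst.isApproxMin h hx).F_sub_add_sq_le lam_pos hz
  rw [F_z, hst.α_div_lam, hst.ξ_div_lam] at value_le
  calc P.F x - P.optVal
      ≤ st.lam / 2 * ‖st.θ‖ ^ 2 + p.α1 / p.lam1 ^ 2 * st.lam
        + p.ξ1 / p.lam1 ^ 2 * st.lam * ‖x - z‖ :=
        (le_add_of_nonneg_right (by positivity)).trans value_le
    _ ≤ st.lam / 2 * (p.dualConst * P.Theta) ^ 2 + p.α1 / p.lam1 ^ 2 * st.lam
        + p.ξ1 / p.lam1 ^ 2 * st.lam * (2 * p.radius) := by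
      gcongr
      exact hst.norm_θ_le
    _ = p.dualConst ^ 2 / 2 * P.Theta ^ 2 * st.lam + (p.α1 / p.lam1 ^ 2
        + 2 * (p.ξ1 / p.lam1 ^ 2) * p.radius) * st.lam := by ring
    _ ≤ p.dualConst ^ 2 / 2 * P.Theta ^ 2 * st.lam + (p.α1 / p.lam1 ^ 2
        + 2 * (p.ξ1 / p.lam1 ^ 2) * p.radius) * P.Theta ^ 2 * st.lam := by
      gcongr
      exact le_mul_of_one_le_right (by positivity) (one_le_pow₀ h.one_le_Theta)
    _ = _ := by ring

theorem optVal_sub_F_le (hst : p.Controlled P st) (h : p.Admits P low x0)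
    (hx : P.Accept st.lam st.α st.ξ st.θ x) :
    P.optVal - P.F x
      ≤ 2 * p.dualConst * p.lip * p.preimageConst * P.Theta ^ 2 * st.lam := by
  -- Repair the residual: `x + d` is feasible and `d` is as small as the residual.
  obtain ⟨d, hd, norm_d_le⟩ := h.exists_fullA_eq (P.b - P.fullA x)
  rw [norm_sub_rev] at norm_d_le
  have lip_nonneg := h.lip_nonneg
  have Theta_nonneg := zero_le_one.trans h.one_le_Theta
  have W_nonneg := p.preimageConst_nonneg
  calc P.optVal - P.F x ≤ p.lip * ‖d‖ := sub_le_iff_le_add'.2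
        ((Problem.optVal_le h.rho h.gamma (by rw [map_add, hd, add_sub_cancel])).trans
          (Problem.F_add_le h.rho h.gamma h.norm_gradient_le x d))
    _ ≤ p.lip * (p.preimageConst * P.Theta * (2 * p.dualConst * P.Theta * st.lam)) := by
      gcongr
      exact norm_d_le.trans (by gcongr; exact hst.norm_residual_le h hx)
    _ = _ := by ring

theorem abs_F_sub_optVal_le (hst : p.Controlled P st) (h : p.Admits P low x0)
    (hx : P.Accept st.lam st.α st.ξ st.θ x) :
    |P.F x - P.optVal| ≤ p.optConst * P.Theta ^ 2 * st.lam := by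
  have upper := hst.F_sub_optVal_le h hx
  have lower := hst.optVal_sub_F_le h hx
  have lam_pos := hst.lam_pos
  have a_nonneg : 0 ≤ p.α1 / p.lam1 ^ 2 := (div_pos p.α1_pos (pow_pos p.lam1_pos 2)).le
  have e_nonneg : 0 ≤ p.ξ1 / p.lam1 ^ 2 := (div_pos p.ξ1_pos (pow_pos p.lam1_pos 2)).le
  have R_nonneg : 0 ≤ p.radius := h.D_nonneg.trans (D_le_radius h.D_nonneg)
  have T_nonneg := zero_le_one.trans (one_le_dualConst h.lip_nonneg)
  have lip_nonneg := h.lip_nonneg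
  have W_nonneg := p.preimageConst_nonneg
  rw [optConst, add_mul, add_mul]
  exact abs_sub_le_iff.2 ⟨upper.trans (le_add_of_nonneg_right (by positivity)),
    lower.trans (le_add_of_nonneg_left (by positivity))⟩

end Accepted

end Controlled

end Params

/-! ### Complexity -/

theorem sum_inv_pow_le {c : ℝ} (hc0 : 0 < c) (hc1 : c < 1) (j : ℕ) :
    ∑ k ∈ Finset.range (j + 1), (c ^ k)⁻¹ ≤ (c ^ j)⁻¹ / (1 - c) := by
  have gap_pos : 0 < 1 - c := sub_pos.2 hc1
  induction j with
  | zero =>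
    rw [zero_add, Finset.sum_range_one, pow_zero, inv_one]
    exact one_le_one_div gap_pos (sub_le_self 1 hc0.le)
  | succ j ih =>
    calc ∑ k ∈ Finset.range (j + 1 + 1), (c ^ k)⁻¹
        ≤ (c ^ j)⁻¹ / (1 - c) + (c ^ (j + 1))⁻¹ := by
          rw [Finset.sum_range_succ]
          exact add_le_add_left ih _
      _ = (c ^ (j + 1))⁻¹ / (1 - c) := by
          field_simp
          ring

theorem exists_mul_pow_le_one {c r : ℝ} (hc0 : 0 < c) (hc1 : c < 1) (hr : 0 ≤ r) :
    ∃ j : ℕ, r * c ^ j ≤ 1 ∧ (c ^ j)⁻¹ ≤ 1 + r / c := by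
  rcases le_or_gt r 1 with r_le | r_gt
  · refine ⟨0, by rwa [pow_zero, mul_one], ?_⟩
    rw [pow_zero, inv_one]
    exact le_add_of_nonneg_right (div_nonneg hr hc0.le)
  · have r_pos := one_pos.trans r_gt
    obtain ⟨i, lt_inv, inv_le⟩ :=
      exists_nat_pow_near_of_lt_one (inv_pos.2 r_pos) (inv_le_one_of_one_le₀ r_gt.le) hc0 hc1
    refine ⟨i + 1, (mul_le_mul_of_nonneg_left lt_inv.le hr).trans_eq
      (mul_inv_cancel₀ r_pos.ne'), ?_⟩
    calc (c ^ (i + 1))⁻¹ = (c ^ i)⁻¹ / c := by rw [pow_succ, mul_inv, div_eq_mul_inv]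
      _ ≤ r / c := by
        gcongr
        exact inv_le_of_inv_le₀ r_pos inv_le
      _ ≤ 1 + r / c := le_add_of_nonneg_left zero_le_one

namespace Params

variable {N n m : ℕ} {p : Params N} {P : Problem N n m} {low : Fin N → ℝ} {x0 : BlockVec N n}
  {st : State N n m}

namespace Controlled

theorem weight_pos (hst : p.Controlled P st) (h : p.Admits P low x0) (i : Fin N) :
    0 < st.lam * p.Lγ i + sigmaMax P.fullA ^ 2 :=
  add_pos_of_nonneg_of_pos (mul_nonneg hst.lam_pos.le (h.Lγ_nonneg i)) (pow_pos h.sigmaMax_pos 2)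

theorem weight_le (hst : p.Controlled P st) (h : p.Admits P low x0) (i : Fin N) :
    st.lam * p.Lγ i + sigmaMax P.fullA ^ 2 ≤ p.weightConst * sigmaMax P.fullA ^ 2 := by
  have s_pos := p.s_pos
  have lam1_pos := p.lam1_pos
  have Λ_nonneg : 0 ≤ ⨆ j, p.Lγ j := Real.iSup_nonneg h.Lγ_nonneg
  have ratio_ge : 1 ≤ sigmaMax P.fullA ^ 2 / p.s ^ 2 :=
    (one_le_div (by positivity)).2 (pow_le_pow_left₀ s_pos.le h.s_le 2)
  calc st.lam * p.Lγ i + sigmaMax P.fullA ^ 2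
      ≤ p.lam1 * (⨆ j, p.Lγ j) + sigmaMax P.fullA ^ 2 :=
        add_le_add_left (mul_le_mul hst.lam_le (le_ciSup (Set.finite_range p.Lγ).bddAbove i)
          (h.Lγ_nonneg i) lam1_pos.le) _
    _ ≤ p.lam1 * (⨆ j, p.Lγ j) * (sigmaMax P.fullA ^ 2 / p.s ^ 2) + sigmaMax P.fullA ^ 2 :=
        add_le_add_left (le_mul_of_one_le_right (by positivity) ratio_ge) _
    _ = p.weightConst * sigmaMax P.fullA ^ 2 := by
      rw [weightConst]
      ring

theorem exists_minimizer_norm_sub_le (hst : p.Controlled P st) (h : p.Admits P low x0) :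
    ∃ z, (∀ w, P.subObj st.lam st.θ z ≤ P.subObj st.lam st.θ w) ∧
      ‖st.x - z‖ ≤ 2 * p.radius := by
  obtain ⟨z, hz⟩ := Problem.exists_forall_subObj_le h.rho h.gamma hst.lam_pos st.θ
  have accept_z : P.Accept st.lam st.α st.ξ st.θ z :=
    Or.inl fun w => (sub_nonpos.2 (hz w)).trans hst.α_pos.le
  refine ⟨z, hz, ?_⟩
  linarith [norm_sub_le st.x z, hst.norm_x_le, hst.norm_le_radius h accept_z]

theorem succ_mem_acceptedCounts (hst : p.Controlled P st) (h : p.Admits P low x0) {ℓ : ℕ}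
    (hℓ : Real.sqrt (8 * p.weightConst * p.radius ^ 2 / (p.α1 / p.lam1 ^ 2))
      * sigmaMax P.fullA / st.lam ≤ ℓ) :
    ℓ + 1 ∈ P.acceptedCounts p.Lγ st := by
  obtain ⟨z, hz, distance_le⟩ := hst.exists_minimizer_norm_sub_le h
  have α1_pos := p.α1_pos
  have lam1_pos := p.lam1_pos
  have H_pos := p.weightConst_pos (Real.iSup_nonneg h.Lγ_nonneg)
  have σ_pos := h.sigmaMax_pos
  have lam_pos := hst.lam_pos
  have α_nonneg := hst.α_pos.le
  refine Problem.succ_mem_acceptedCounts h.rho h.gamma lam_pos.le (hst.weight_pos h)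
    (hst.weight_le h) hz ?_
  calc 2 * (p.weightConst * sigmaMax P.fullA ^ 2 * ‖st.x - z‖ ^ 2)
      ≤ 2 * (p.weightConst * sigmaMax P.fullA ^ 2 * (2 * p.radius) ^ 2) := by gcongr
    _ = 8 * p.weightConst * p.radius ^ 2 / (p.α1 / p.lam1 ^ 2) * sigmaMax P.fullA ^ 2
        / st.lam ^ 2 * st.α := by
      rw [hst.α_eq]
      field_simp
      ring
    _ = (Real.sqrt (8 * p.weightConst * p.radius ^ 2 / (p.α1 / p.lam1 ^ 2))
        * sigmaMax P.fullA / st.lam) ^ 2 * st.α := by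
      rw [div_pow, mul_pow, Real.sq_sqrt (by positivity)]
    _ ≤ (ℓ + 2) ^ 2 * st.α := by
      gcongr
      exact hℓ.trans (le_add_of_nonneg_right zero_le_two)

theorem nonempty_acceptedCounts (hst : p.Controlled P st) (h : p.Admits P low x0) :
    (P.acceptedCounts p.Lγ st).Nonempty :=
  ⟨_, hst.succ_mem_acceptedCounts h (Nat.le_ceil _)⟩

theorem innerCount_le (hst : p.Controlled P st) (h : p.Admits P low x0) :
    (P.innerCount p.Lγ st : ℝ) ≤ p.countConst * sigmaMax P.fullA / st.lam := by
  have σ_pos := h.sigmaMax_pos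
  have lam_pos := hst.lam_pos
  have s_pos := p.s_pos
  set q := Real.sqrt (8 * p.weightConst * p.radius ^ 2 / (p.α1 / p.lam1 ^ 2))
    * sigmaMax P.fullA / st.lam with hq
  have one_le_ratio : 1 ≤ p.lam1 / p.s * sigmaMax P.fullA / st.lam := by
    rw [div_mul_eq_mul_div, div_div, one_le_div (by positivity), mul_comm p.s]
    exact mul_le_mul hst.lam_le h.s_le s_pos.le p.lam1_pos.le
  have innerCount_le_ceil : P.innerCount p.Lγ st ≤ ⌈q⌉₊ + 1 :=
    Nat.sInf_le (hst.succ_mem_acceptedCounts h (Nat.le_ceil q))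
  calc (P.innerCount p.Lγ st : ℝ) ≤ ⌈q⌉₊ + 1 := mod_cast innerCount_le_ceil
    _ ≤ q + 2 := by linarith [Nat.ceil_lt_add_one (by positivity : 0 ≤ q)]
    _ ≤ q + 2 * (p.lam1 / p.s * sigmaMax P.fullA / st.lam) := by linarith
    _ = p.countConst * sigmaMax P.fullA / st.lam := by
      rw [hq, countConst]
      ring

theorem accept_dfalStep (hst : p.Controlled P st) (h : p.Admits P low x0) :
    P.Accept st.lam st.α st.ξ st.θ (P.dfalStep p.Lγ p.c st).x :=
  (Nat.sInf_mem (hst.nonempty_acceptedCounts h)).2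

theorem dfalStep (hst : p.Controlled P st) (h : p.Admits P low x0) :
    p.Controlled P (P.dfalStep p.Lγ p.c st) where
  lam_pos := mul_pos p.c_pos hst.lam_pos
  lam_le := (mul_le_of_le_one_left hst.lam_pos.le p.c_lt_one.le).trans hst.lam_le
  α_eq := by
    simp only [Problem.dfalStep, hst.α_eq]
    ring
  ξ_eq := by
    simp only [Problem.dfalStep, hst.ξ_eq]
    ring
  energy_le := hst.energy_dualUpdate_le h (hst.accept_dfalStep h)
  norm_θ_le := hst.norm_dualUpdate_le h (hst.accept_dfalStep h)
  norm_x_le := hst.norm_le_radius h (hst.accept_dfalStep h)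

end Controlled

variable (p) in
/-- The state after `k` iterations of DFAL with the parameters `p`. -/
abbrev run (P : Problem N n m) (x0 : BlockVec N n) (k : ℕ) : State N n m :=
  P.dfal p.Lγ p.c p.lam1 p.α1 p.ξ1 x0 k

theorem run_lam (k : ℕ) : (p.run P x0 k).lam = p.c ^ k * p.lam1 := by
  induction k with
  | zero => rw [pow_zero, one_mul, run, Problem.dfal]
  | succ k ih => rw [pow_succ', mul_assoc, ← ih, run, Problem.dfal, Problem.dfalStep]

theorem Admits.controlled_run (h : p.Admits P low x0) (k : ℕ) :
    p.Controlled P (p.run P x0 k) := by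
  induction k with
  | zero =>
    have lam1_ne := p.lam1_pos.ne'
    have Theta_nonneg := zero_le_one.trans h.one_le_Theta
    have T_nonneg := zero_le_one.trans (one_le_dualConst h.lip_nonneg)
    exact
      { lam_pos := p.lam1_pos
        lam_le := le_rfl
        α_eq := (div_mul_cancel₀ _ (pow_ne_zero 2 lam1_ne)).symm
        ξ_eq := (div_mul_cancel₀ _ (pow_ne_zero 2 lam1_ne)).symm
        energy_le := by
          simpa [run, Problem.dfal] using dualEnergy_nonneg h.D_nonneg
        norm_θ_le := by
          simpa [run, Problem.dfal] using mul_nonneg T_nonneg Theta_nonneg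
        norm_x_le := h.norm_x0_le.trans (D_le_radius h.D_nonneg) }
  | succ k ih => exact ih.dfalStep h

theorem Admits.accept_run_succ (h : p.Admits P low x0) (k : ℕ) :
    P.Accept (p.run P x0 k).lam (p.run P x0 k).α (p.run P x0 k).ξ (p.run P x0 k).θ
      (p.run P x0 (k + 1)).x :=
  (h.controlled_run k).accept_dfalStep h

variable (p) in
/-- The constant in the bound for the number of inner iterations after which an accuracy measure
that is at most `q Q λ⁽ᵏ⁾` along the iterates stays below a given tolerance. -/
def totalConst (q : ℝ) : ℝ := (1 / p.lam1 + q / p.c) / (1 - p.c) * p.countConst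

theorem Admits.totalInner_le (h : p.Admits P low x0) {j K : ℕ} (hK : K ≤ j + 1) :
    (P.totalInner p.Lγ p.c p.lam1 p.α1 p.ξ1 x0 K : ℝ)
      ≤ p.countConst * sigmaMax P.fullA / p.lam1 * ((p.c ^ j)⁻¹ / (1 - p.c)) := by
  have := p.lam1_pos
  have := h.sigmaMax_pos
  have := p.countConst_nonneg
  calc (P.totalInner p.Lγ p.c p.lam1 p.α1 p.ξ1 x0 K : ℝ)
      ≤ ∑ k ∈ Finset.range (j + 1), (P.innerCount p.Lγ (p.run P x0 k) : ℝ) :=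
        mod_cast Finset.sum_le_sum_of_subset (Finset.range_mono hK)
    _ ≤ ∑ k ∈ Finset.range (j + 1),
          p.countConst * sigmaMax P.fullA / p.lam1 * (p.c ^ k)⁻¹ :=
        Finset.sum_le_sum fun k _ => ((h.controlled_run k).innerCount_le h).trans_eq (by
          rw [run_lam, div_mul_eq_div_div_swap, div_eq_mul_inv _ (p.c ^ k)])
    _ ≤ p.countConst * sigmaMax P.fullA / p.lam1 * ((p.c ^ j)⁻¹ / (1 - p.c)) := by
        rw [← Finset.mul_sum]
        exact mul_le_mul_of_nonneg_left (sum_inv_pow_le p.c_pos p.c_lt_one j) (by positivity)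

theorem Admits.exists_isLeast_totalInner_le (h : p.Admits P low x0) {q Q ε : ℝ} (hq : 0 ≤ q)
    (hQ : 1 ≤ Q) (hε0 : 0 < ε) (hε1 : ε ≤ 1) {good : BlockVec N n → Prop}
    (hgood : ∀ k, q * Q * (p.run P x0 k).lam ≤ ε → good (p.run P x0 (k + 1)).x) :
    ∃ K, IsLeast {K | 1 ≤ K ∧ ∀ k, K ≤ k → good (p.run P x0 k).x} K ∧
      (P.totalInner p.Lγ p.c p.lam1 p.α1 p.ξ1 x0 K : ℝ)
        ≤ p.totalConst q * (Q * sigmaMax P.fullA * ε⁻¹) := by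
  have lam1_pos := p.lam1_pos
  have c_pos := p.c_pos
  have gap_pos := sub_pos.2 p.c_lt_one
  have σ_pos := h.sigmaMax_pos
  have E_nonneg := p.countConst_nonneg
  obtain ⟨j, accurate, inv_pow_le⟩ := exists_mul_pow_le_one (r := q * Q * p.lam1 / ε) p.c_pos
    p.c_lt_one (by positivity)
  have mem : j + 1 ∈ {K | 1 ≤ K ∧ ∀ k, K ≤ k → good (p.run P x0 k).x} := by
    refine ⟨Nat.le_add_left 1 j, fun k hk => ?_⟩
    obtain ⟨i, rfl⟩ := Nat.exists_eq_add_of_le' hk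
    refine hgood (i + j) ?_
    rw [div_mul_eq_mul_div, div_le_one hε0] at accurate
    calc q * Q * (p.run P x0 (i + j)).lam = q * Q * p.lam1 * p.c ^ (i + j) := by
          rw [run_lam]
          ring
      _ ≤ q * Q * p.lam1 * p.c ^ j := by
        gcongr ?_ * ?_
        exact pow_le_pow_of_le_one c_pos.le p.c_lt_one.le (Nat.le_add_left j i)
      _ ≤ ε := accurate
  have one_le_tol : 1 ≤ Q * ε⁻¹ :=
    one_le_mul_of_one_le_of_one_le hQ ((one_le_inv₀ hε0).2 hε1)
  refine ⟨_, isLeast_csInf ⟨_, mem⟩, (h.totalInner_le (Nat.sInf_le mem)).trans ?_⟩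
  calc p.countConst * sigmaMax P.fullA / p.lam1 * ((p.c ^ j)⁻¹ / (1 - p.c))
      ≤ p.countConst * sigmaMax P.fullA / p.lam1
        * ((1 * (Q * ε⁻¹) + q * Q * p.lam1 / ε / p.c) / (1 - p.c)) := by
        gcongr
        linarith
    _ = p.totalConst q * (Q * sigmaMax P.fullA * ε⁻¹) := by
      rw [totalConst]
      field_simp

theorem Admits.exists_isLeast_epsOptimal (h : p.Admits P low x0) {ε : ℝ} (hε0 : 0 < ε)
    (hε1 : ε ≤ 1) :
    ∃ K, IsLeast {K | 1 ≤ K ∧ ∀ k, K ≤ k → P.EpsOptimal ε (p.run P x0 k).x} K ∧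
      (P.totalInner p.Lγ p.c p.lam1 p.α1 p.ξ1 x0 K : ℝ)
        ≤ p.totalConst p.optConst * (P.Theta ^ 2 * sigmaMax P.fullA * ε⁻¹) :=
  h.exists_isLeast_totalInner_le (optConst_nonneg h.D_nonneg h.lip_nonneg)
    (one_le_pow₀ h.one_le_Theta) hε0 hε1 fun k =>
      ((h.controlled_run k).abs_F_sub_optVal_le h (h.accept_run_succ k)).trans

theorem Admits.exists_isLeast_epsFeasible (h : p.Admits P low x0) {ε : ℝ} (hε0 : 0 < ε)
    (hε1 : ε ≤ 1) :
    ∃ K, IsLeast {K | 1 ≤ K ∧ ∀ k, K ≤ k → P.EpsFeasible ε (p.run P x0 k).x} K ∧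
      (P.totalInner p.Lγ p.c p.lam1 p.α1 p.ξ1 x0 K : ℝ)
        ≤ p.totalConst (2 * p.dualConst) * (P.Theta * sigmaMax P.fullA * ε⁻¹) :=
  h.exists_isLeast_totalInner_le
    (mul_nonneg zero_le_two (zero_le_one.trans (one_le_dualConst h.lip_nonneg)))
    h.one_le_Theta hε0 hε1 fun k =>
      ((h.controlled_run k).norm_residual_le h (h.accept_run_succ k)).trans

end Params

end DFAL

end

theorem mainTheorem2
    -- what the constant `C` may depend on
    (N : ℕ) (τ B G Lγ : Fin N → ℝ) (c lam1 α1 ξ1 D s κ : ℝ)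
    (hc0 : 0 < c) (hc1 : c < 1)
    (hlam1 : 0 < lam1) (hα1 : 0 < α1) (hξ1 : 0 < ξ1) (hξτ : ∀ i, ξ1 / lam1 < τ i)
    (hs : 0 < s) :
    ∃ C : ℝ, 0 < C ∧
      ∀ (n m : ℕ) (P : DFAL.Problem N n m) (low : Fin N → ℝ) (x0 : DFAL.BlockVec N n),
        (∀ i, DFAL.IsRegularizer (P.rho i) (B i) (τ i)) →
        (∀ i, DFAL.IsSmoothTerm (P.gamma i) (Lγ i) (low i)) →
        (∀ i x, ‖gradient (P.gamma i) x‖ ≤ G i) →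
        Function.Surjective P.fullA →
        (∀ i, 0 < DFAL.sigmaMin (P.A i)) →
        s ≤ DFAL.sigmaMax P.fullA →
        (n < m → P.minSigma ≤ κ * DFAL.sigmaMin P.fullA) →
        P.optVal - ∑ i, low i ≤ D →
        ‖x0‖ ≤ D →
        -- every inner call terminates
        (∀ k, (P.acceptedCounts Lγ (P.dfal Lγ c lam1 α1 ξ1 x0 k)).Nonempty) ∧
        ∀ ε : ℝ, 0 < ε → ε ≤ 1 →
          (∃ K : ℕ,
            IsLeast {K | 1 ≤ K ∧ ∀ k, K ≤ k →
              P.EpsOptimal ε (P.dfal Lγ c lam1 α1 ξ1 x0 k).x} K ∧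
            (P.totalInner Lγ c lam1 α1 ξ1 x0 K : ℝ)
              ≤ C * (P.Theta ^ 2 * DFAL.sigmaMax P.fullA * ε⁻¹)) ∧
          (∃ K : ℕ,
            IsLeast {K | 1 ≤ K ∧ ∀ k, K ≤ k →
              P.EpsFeasible ε (P.dfal Lγ c lam1 α1 ξ1 x0 k).x} K ∧
            (P.totalInner Lγ c lam1 α1 ξ1 x0 K : ℝ)
              ≤ C * (P.Theta * DFAL.sigmaMax P.fullA * ε⁻¹)) := by
  obtain ⟨δ, δ_pos, slope_lt⟩ := Pi.exists_forall_pos_add_lt (x := fun _ => ξ1 / lam1) hξτ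
  let p : DFAL.Params N :=
    { τ, B, G, Lγ, c, lam1, α1, ξ1, D, s, κ, δ
      c_pos := hc0
      c_lt_one := hc1
      lam1_pos := hlam1
      α1_pos := hα1
      ξ1_pos := hξ1
      s_pos := hs
      δ_pos := δ_pos
      slope_add_le := fun i => (slope_lt i).le }
  refine ⟨max 1 (max (p.totalConst p.optConst) (p.totalConst (2 * p.dualConst))),
    lt_max_of_lt_left one_pos, fun n m P low x0 hρ hγ hG hA hAi hsσ hκ hgap hx0 => ?_⟩
  have h : p.Admits P low x0 := ⟨hρ, hγ, hG, hA, hAi, hsσ, hκ, hgap, hx0⟩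
  have σ_pos := h.sigmaMax_pos
  have Theta_nonneg := zero_le_one.trans h.one_le_Theta
  refine ⟨fun k => (h.controlled_run k).nonempty_acceptedCounts h, fun ε hε0 hε1 => ⟨?_, ?_⟩⟩
  · obtain ⟨K, least, total_le⟩ := h.exists_isLeast_epsOptimal hε0 hε1
    exact ⟨K, least, total_le.trans (mul_le_mul_of_nonneg_right
      ((le_max_left _ _).trans (le_max_right _ _)) (by positivity))⟩
  · obtain ⟨K, least, total_le⟩ := h.exists_isLeast_epsFeasible hε0 hε1
    exact ⟨K, least, total_le.trans (mul_le_mul_of_nonneg_right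
      ((le_max_right _ _).trans (le_max_right _ _)) (by positivity))⟩
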